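/- Let $n\ge 0$ be an integer and $q,p\in\mathbb{C}\setminus\{0\}$. For $i,j,k,l\in\{1,\dots,n\}$ define $R_{ij}^{kl}\in\mathbb{C}$ (the two-parameter Cremmer–Gervais $R$-matrix) by $$pR_{ij}^{kl}=\begin{cases} q\,p^{2(l-i)}, & i=k\ge j=l,\\ q^{-1}p^{2(l-i)}, & i=k<j=l,\\ (q-q^{-1})\,p^{2(l-i)}, & j\le k<i,\ i+j=k+l,\\ (q^{-1}-q)\,p^{2(l-i)}, & i<k<j,\ i+j=k+l,\\ 0, & \text{otherwise.}\end{cases}$$ Consider the following associative unital $\mathbb{C}$-algebras, where relations are imposed for all values of the free indices: - $S(R)$, generated by $x_1,\dots,x_n$ with relations $q\,x_jx_i=p\sum_{k,l}R_{ij}^{kl}x_kx_l$; - $\Lambda(R)$, generated by $x_1,\dots,x_n$ with relations $q^{-1}x_jx_i+p\sum_{k,l}R_{ij}^{kl}x_kx_l=0$; - $A(R)$, generated by $T_i^k$ ($1\le i,k\le n$) with relations $\sum_{u,v}R_{ji}^{uv}T_u^kT_v^l=\sum_{u,v}R_{vu}^{kl}T_i^uT_j^v$. Each is graded by giving the generators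 degree $1$. For such a graded algebra $B=\bigoplus_m B_m$ put $P_B(t)=\sum_{m\ge0}(\dim_{\mathbb{C}} B_m)\,t^m$. **Theorem.** 1. If $q^2\ne-1$, then $\Lambda(R)$ is presented by the generators $x_1,\dots,x_n$ and the relations $x_i^2=0$ and $x_ix_j=-p^{2(i-j)}x_jx_i$ for all $i,j$; that is, the algebra defined by these generators and relations is isomorphic to $\Lambda(R)$ by the map $x_i\mapsto x_i$. Moreover $P_{\Lambda(R)}(t)=(1+t)^n$. 2. $P_{S(R)}(t)=(1-t)^{-n}$ and $P_{A(R)}(t)=(1-t)^{-n^2}$. -/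

import Mathlib

open scoped DirectSum

namespace CremmerGervais

/-! ### Algebras given by generators and homogeneous quadratic relations -/

section Quadratic

variable {X : Type} (r : FreeAlgebra ℂ X → FreeAlgebra ℂ X → Prop)

/-- The image of the generator `x` in the quotient of the free algebra by the relations `r`. -/
noncomputable def gen (x : X) : RingQuot r := RingQuot.mkAlgHom ℂ r (FreeAlgebra.ι ℂ x)

/-- The degree `m` part: the span of all products of `m` generators. -/
noncomputable def degPart (m : ℕ) : Submodule ℂ (RingQuot r) :=
  Submodule.span ℂ (Set.range (gen r)) ^ m

/-- The span of the free generators. -/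
noncomputable def freeSpan (X : Type) : Submodule ℂ (FreeAlgebra ℂ X) :=
  Submodule.span ℂ (Set.range (FreeAlgebra.ι ℂ))

instance degPart_gradedMonoid : SetLike.GradedMonoid (degPart r) :=
  inferInstanceAs (SetLike.GradedMonoid (fun m : ℕ =>
    Submodule.span ℂ (Set.range (gen r)) ^ m))

theorem gen_mem (x : X) : gen r x ∈ degPart r 1 := by
  rw [degPart, pow_one]
  exact Submodule.subset_span ⟨x, rfl⟩

theorem mk_mem {m : ℕ} {a : FreeAlgebra ℂ X} (ha : a ∈ freeSpan X ^ m) :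
    RingQuot.mkAlgHom ℂ r a ∈ degPart r m := by
  have h : (freeSpan X ^ m).map (RingQuot.mkAlgHom ℂ r).toLinearMap = degPart r m := by
    rw [Submodule.map_pow, freeSpan, Submodule.map_span, ← Set.range_comp]
    rfl
  rw [← h]
  exact ⟨a, ha, rfl⟩

/-- The map from the free algebra to the direct sum of the degree parts. -/
noncomputable def toSum : FreeAlgebra ℂ X →ₐ[ℂ] ⨁ m, degPart r m :=
  FreeAlgebra.lift ℂ fun x => DirectSum.of (fun m => degPart r m) 1 ⟨gen r x, gen_mem r x⟩

theorem toSum_apply {m : ℕ} {a : FreeAlgebra ℂ X} (ha : a ∈ freeSpan X ^ m) :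
    toSum r a = DirectSum.of (fun m => degPart r m) m
      ⟨RingQuot.mkAlgHom ℂ r a, mk_mem r ha⟩ := by
  induction ha using Submodule.pow_induction_on_left' with
  | algebraMap c =>
    rw [AlgHom.commutes, DirectSum.algebraMap_apply]
    exact congrArg _ (Subtype.ext ((RingQuot.mkAlgHom ℂ r).commutes c).symm)
  | add x y i hx hy ihx ihy =>
    rw [map_add, ihx, ihy, ← map_add]
    exact congrArg _ (Subtype.ext (map_add _ _ _).symm)
  | mem_mul v hv i x hx ih =>
    have key : toSum r v = DirectSum.of (fun m => degPart r m) 1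
        ⟨RingQuot.mkAlgHom ℂ r v, mk_mem r (by rwa [pow_one])⟩ := by
      clear ih
      induction hv using Submodule.span_induction with
      | mem v h =>
        obtain ⟨x, rfl⟩ := h
        exact FreeAlgebra.lift_ι_apply _ _
      | zero =>
        rw [map_zero, ← map_zero (DirectSum.of (fun m => degPart r m) 1)]
        exact congrArg _ (Subtype.ext (map_zero _).symm)
      | add x y hx hy ihx ihy =>
        rw [map_add, ihx, ihy, ← map_add]
        exact congrArg _ (Subtype.ext (map_add _ _ _).symm)
      | smul c x hx ihx =>
        rw [map_smul, ihx, ← DirectSum.of_smul]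
        exact congrArg _ (Subtype.ext (map_smul _ _ _).symm)
    rw [map_mul, ih, key, DirectSum.of_mul_of]
    exact DirectSum.of_eq_of_gradedMonoid_eq
      (Sigma.subtype_ext (add_comm _ _) (map_mul _ _ _).symm)

/-- If all relations are homogeneous of degree two, the quotient is graded by the word length. -/
noncomputable abbrev quadGraded
    (hr : ∀ ⦃a b⦄, r a b → a ∈ freeSpan X ^ 2 ∧ b ∈ freeSpan X ^ 2) :
    GradedAlgebra (degPart r) :=
  GradedAlgebra.ofAlgHom (degPart r)
    (RingQuot.liftAlgHom ℂ ⟨toSum r, fun {a b} h => by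
      rw [toSum_apply r (hr h).1, toSum_apply r (hr h).2]
      exact congrArg _ (Subtype.ext (RingQuot.mkAlgHom_rel ℂ h))⟩)
    (by
      ext x
      simp only [AlgHom.comp_apply, RingQuot.liftAlgHom_mkAlgHom_apply, Function.comp_apply,
        AlgHom.id_apply, toSum, FreeAlgebra.lift_ι_apply, DirectSum.coeAlgHom_of]
      rfl)
    (fun m x => by
      obtain ⟨x, hx⟩ := x
      have h : (freeSpan X ^ m).map (RingQuot.mkAlgHom ℂ r).toLinearMap = degPart r m := by
        rw [Submodule.map_pow, freeSpan, Submodule.map_span, ← Set.range_comp]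
        rfl
      obtain ⟨a, ha, rfl⟩ := h.symm ▸ hx
      exact (RingQuot.liftAlgHom_mkAlgHom_apply ℂ _ _ a).trans (toSum_apply r ha))

end Quadratic

theorem quad_mem {X : Type} (x y : X) :
    FreeAlgebra.ι ℂ x * FreeAlgebra.ι ℂ y ∈ freeSpan X ^ 2 := by
  rw [pow_two]
  exact Submodule.mul_mem_mul (Submodule.subset_span ⟨x, rfl⟩) (Submodule.subset_span ⟨y, rfl⟩)

/-- The Poincaré series `∑ (dim A_m) t^m` of a graded algebra `A = ⨁ A_m`. -/
noncomputable def poincareSeries {A : Type} [Ring A] [Algebra ℂ A] (𝒜 : ℕ → Submodule ℂ A)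
    [GradedAlgebra 𝒜] : PowerSeries ℚ :=
  PowerSeries.mk fun m => (Module.finrank ℂ (𝒜 m) : ℚ)

/-! ### The two-parameter Cremmer-Gervais matrix and its algebras -/

/-- The entry `R_{ij}^{kl}` of the two-parameter Cremmer-Gervais matrix, for which
`R (e_i ⊗ e_j) = ∑_{k,l} R_{ij}^{kl} e_k ⊗ e_l`. -/
noncomputable def R (n : ℕ) (q p : ℂ) (i j k l : Fin n) : ℂ :=
  p⁻¹ *
    (if i = k ∧ j = l ∧ j ≤ i then q * p ^ (2 * ((l : ℤ) - (i : ℤ)))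
    else if i = k ∧ j = l ∧ i < j then q⁻¹ * p ^ (2 * ((l : ℤ) - (i : ℤ)))
    else if j ≤ k ∧ k < i ∧ (i : ℕ) + j = k + l then
      (q - q⁻¹) * p ^ (2 * ((l : ℤ) - (i : ℤ)))
    else if i < k ∧ k < j ∧ (i : ℕ) + j = k + l then
      (q⁻¹ - q) * p ^ (2 * ((l : ℤ) - (i : ℤ)))
    else 0)

/-- `q x_j x_i = p ∑_{k,l} R_{ij}^{kl} x_k x_l`. -/
inductive SymRel (n : ℕ) (q p : ℂ) : FreeAlgebra ℂ (Fin n) → FreeAlgebra ℂ (Fin n) → Prop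
  | rel (i j : Fin n) : SymRel n q p
      (q • (FreeAlgebra.ι ℂ j * FreeAlgebra.ι ℂ i))
      (p • ∑ k, ∑ l, R n q p i j k l • (FreeAlgebra.ι ℂ k * FreeAlgebra.ι ℂ l))

/-- `q⁻¹ x_j x_i + p ∑_{k,l} R_{ij}^{kl} x_k x_l = 0`. -/
inductive ExtRel (n : ℕ) (q p : ℂ) : FreeAlgebra ℂ (Fin n) → FreeAlgebra ℂ (Fin n) → Prop
  | rel (i j : Fin n) : ExtRel n q p
      (q⁻¹ • (FreeAlgebra.ι ℂ j * FreeAlgebra.ι ℂ i) +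
        p • ∑ k, ∑ l, R n q p i j k l • (FreeAlgebra.ι ℂ k * FreeAlgebra.ι ℂ l)) 0

/-- `∑_{u,v} R_{ji}^{uv} T_u^k T_v^l = ∑_{u,v} R_{vu}^{kl} T_i^u T_j^v`; the generator `T_i^k`
is indexed by the pair `(i, k)`. -/
inductive FRTRel (n : ℕ) (q p : ℂ) :
    FreeAlgebra ℂ (Fin n × Fin n) → FreeAlgebra ℂ (Fin n × Fin n) → Prop
  | rel (i j k l : Fin n) : FRTRel n q p
      (∑ u, ∑ v, R n q p j i u v • (FreeAlgebra.ι ℂ (u, k) * FreeAlgebra.ι ℂ (v, l)))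
      (∑ u, ∑ v, R n q p v u k l • (FreeAlgebra.ι ℂ (i, u) * FreeAlgebra.ι ℂ (j, v)))

/-- `x_i ^ 2 = 0` and `x_i x_j = - p ^ (2 (i - j)) x_j x_i`. -/
inductive SkewRel (n : ℕ) (p : ℂ) : FreeAlgebra ℂ (Fin n) → FreeAlgebra ℂ (Fin n) → Prop
  | sq (i : Fin n) : SkewRel n p (FreeAlgebra.ι ℂ i ^ 2) 0
  | swap (i j : Fin n) : SkewRel n p
      (FreeAlgebra.ι ℂ i * FreeAlgebra.ι ℂ j)
      (-(p ^ (2 * ((i : ℤ) - (j : ℤ))) • (FreeAlgebra.ι ℂ j * FreeAlgebra.ι ℂ i)))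

/-- The symmetric algebra `S(R)`. -/
abbrev S (n : ℕ) (q p : ℂ) : Type := RingQuot (SymRel n q p)

/-- The exterior algebra `Λ(R)`. -/
abbrev Ext (n : ℕ) (q p : ℂ) : Type := RingQuot (ExtRel n q p)

/-- The algebra `A(R)`. -/
abbrev A (n : ℕ) (q p : ℂ) : Type := RingQuot (FRTRel n q p)

/-- The algebra with generators `x_i` and relations `SkewRel`. -/
abbrev SkewExt (n : ℕ) (p : ℂ) : Type := RingQuot (SkewRel n p)

noncomputable instance gradedS (n : ℕ) (q p : ℂ) :
    GradedAlgebra (degPart (SymRel n q p)) :=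
  quadGraded _ fun a b h => by
    obtain ⟨i, j⟩ := h
    exact ⟨Submodule.smul_mem _ _ (quad_mem _ _), Submodule.smul_mem _ _ <|
      Submodule.sum_mem _ fun k _ => Submodule.sum_mem _ fun l _ =>
        Submodule.smul_mem _ _ (quad_mem _ _)⟩

noncomputable instance gradedExt (n : ℕ) (q p : ℂ) :
    GradedAlgebra (degPart (ExtRel n q p)) :=
  quadGraded _ fun a b h => by
    obtain ⟨i, j⟩ := h
    exact ⟨Submodule.add_mem _ (Submodule.smul_mem _ _ (quad_mem _ _)) <|
      Submodule.smul_mem _ _ <| Submodule.sum_mem _ fun k _ => Submodule.sum_mem _ fun l _ =>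
        Submodule.smul_mem _ _ (quad_mem _ _), Submodule.zero_mem _⟩

noncomputable instance gradedA (n : ℕ) (q p : ℂ) :
    GradedAlgebra (degPart (FRTRel n q p)) :=
  quadGraded _ fun a b h => by
    obtain ⟨i, j, k, l⟩ := h
    exact ⟨Submodule.sum_mem _ fun k _ => Submodule.sum_mem _ fun l _ =>
        Submodule.smul_mem _ _ (quad_mem _ _),
      Submodule.sum_mem _ fun k _ => Submodule.sum_mem _ fun l _ =>
        Submodule.smul_mem _ _ (quad_mem _ _)⟩

end CremmerGervais

/-! Everything reduces to modules over the Hecke algebra of the symmetric group on m letters. Put V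
= ℂ^n, and let T_s act on V^{⊗m} by pR composed with the flip at positions s and t = s + 1. The dual
of a degree m part is the space of functions on words of length m that vanish on every insertion of
a relation (`finrank_degPart`). For S(R) and Λ(R) these functions are the linear maps V^{⊗m} → ℂ
intertwining every T_s with the scalar q, respectively -q⁻¹ (`finrank_quadSol_eigenCoeff`). For A(R)
they are the endomorphisms of V^{⊗m} commuting with every T_s (`finrank_quadSol_frtCoeff`).

Send words to monomials in m variables, rescaled so as to absorb p. Then T_s becomes the
Demazure-Lusztig operator f ↦ q σf + (q - q⁻¹) x_t (f - σf)/(x_t - x_s), where σ swaps x_s and x_t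
(`toPoly_braidOp`). The Hecke and braid relations become identities of rational functions
(`isHecke_braidOp`), and T_s f = q f means exactly σf = f, for every q ≠ 0 (`braidOp_eq_smul_iff`).

As a Hecke module, V^{⊗m} is a direct sum, over sorted words α, of modules induced from the
character T_s ↦ q of the parabolic subalgebra given by the ties of α. A triangularity argument shows
that sorted words generate (`single_mem_of_stable`), and sorting is independent of the chosen route
(`sortFam_spec`). Frobenius reciprocity follows (`evalMono_bijective`): an intertwiner V^{⊗m} → M is
a free choice, for each sorted α, of a vector of M on which T_s acts by q at each tie.
Semisimplicity plays no role, so roots of unity are allowed.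

It remains to count. For M = ℂ with scalar q every sorted word contributes 1; with scalar -q⁻¹ ≠ q
only strictly increasing words do. For M = V^{⊗m} one counts polynomials symmetric along the ties of
α, that is, sorted words in the n² pairs of letters (`evalLex_bijective`).

The presentation of Λ(R) is proved separately: after a rescaling by powers of p, the relations are
equivalent to antisymmetry, by induction on the distance of the indices (`antisymm_iff`). -/

namespace CremmerGervais

/-! ### Duals of the graded pieces of a quadratic algebra -/

section Duality

variable {X I : Type}

/-- Functions on words of length `m` that vanish on every insertion of the quadratic relations
`∑ c i x y • (x ⊗ y)` at two adjacent positions. -/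
def quadSol [Fintype X] [DecidableEq X] (c : I → X → X → ℂ) (m : ℕ) :
    Submodule ℂ ((Fin m → X) → ℂ) where
  carrier := {φ | ∀ i (s t : Fin m), (s : ℕ) + 1 = t → ∀ w : Fin m → X,
    ∑ x, ∑ y, c i x y * φ (Function.update (Function.update w s x) t y) = 0}
  add_mem' := fun {φ ψ} hφ hψ i s t h w => by
    simp only [Pi.add_apply, mul_add, Finset.sum_add_distrib, hφ i s t h w, hψ i s t h w, add_zero]
  zero_mem' := fun i s t h w => by simp
  smul_mem' := fun a φ hφ i s t h w => by
    simp only [Pi.smul_apply, smul_eq_mul, mul_left_comm _ a, ← Finset.mul_sum, hφ i s t h w,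
      mul_zero]

/-- The analogue of `quadSol` for functions on words of arbitrary length. -/
def listSol [Fintype X] (c : I → X → X → ℂ) : Submodule ℂ (List X → ℂ) where
  carrier := {φ | ∀ i u v, ∑ x, ∑ y, c i x y * φ (u ++ x :: y :: v) = 0}
  add_mem' := fun {φ ψ} hφ hψ i u v => by
    simp only [Pi.add_apply, mul_add, Finset.sum_add_distrib, hφ i u v, hψ i u v, add_zero]
  zero_mem' := fun i u v => by simp
  smul_mem' := fun a φ hφ i u v => by
    simp only [Pi.smul_apply, smul_eq_mul, mul_left_comm _ a, ← Finset.mul_sum, hφ i u v,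
      mul_zero]

/-- Right translation of functions on words by a letter. -/
def appendOp [Fintype X] (c : I → X → X → ℂ) (x : X) : Module.End ℂ (listSol c) where
  toFun φ := ⟨fun l => φ.1 (l ++ [x]), fun i u v => by simpa using φ.2 i u (v ++ [x])⟩
  map_add' _ _ := rfl
  map_smul' _ _ := rfl

variable {r : FreeAlgebra ℂ X → FreeAlgebra ℂ X → Prop} {c : I → X → X → ℂ}

/-- The quotient algebra acts on functions on words that vanish on the relations. -/
noncomputable def actHom [Fintype X]
    (h : ∀ a b, r a b → ∃ i, a - b = ∑ x, ∑ y, c i x y • (FreeAlgebra.ι ℂ x * FreeAlgebra.ι ℂ y)) :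
    RingQuot r →ₐ[ℂ] Module.End ℂ (listSol c) :=
  RingQuot.liftAlgHom ℂ ⟨FreeAlgebra.lift ℂ (appendOp c), fun {a b} hab => by
    obtain ⟨i, hi⟩ := h a b hab
    refine sub_eq_zero.1 ((map_sub (FreeAlgebra.lift ℂ (appendOp c)) a b).symm.trans ?_)
    rw [hi]
    simp only [map_sum, map_smul, map_mul, FreeAlgebra.lift_ι_apply]
    refine LinearMap.ext fun φ => Subtype.ext (funext fun l => ?_)
    simpa [appendOp, LinearMap.sum_apply] using φ.2 i l []⟩

theorem actHom_gen [Fintype X]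
    (h : ∀ a b, r a b → ∃ i, a - b = ∑ x, ∑ y, c i x y • (FreeAlgebra.ι ℂ x * FreeAlgebra.ι ℂ y))
    (x : X) : actHom h (gen r x) = appendOp c x := by
  rw [actHom, gen, RingQuot.liftAlgHom_mkAlgHom_apply, FreeAlgebra.lift_ι_apply]

theorem actHom_list [Fintype X]
    (h : ∀ a b, r a b → ∃ i, a - b = ∑ x, ∑ y, c i x y • (FreeAlgebra.ι ℂ x * FreeAlgebra.ι ℂ y))
    (w l : List X) (φ : listSol c) :
    (actHom h (w.map (gen r)).prod φ).1 l = φ.1 (l ++ w) := by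
  induction w generalizing l with
  | nil => simp
  | cons x w ih =>
    rw [List.map_cons, List.prod_cons, map_mul, actHom_gen, Module.End.mul_apply]
    change (actHom h (w.map (gen r)).prod φ).1 (l ++ [x]) = _
    rw [ih, List.append_assoc]
    rfl

/-- The product of the generators along a word. -/
noncomputable def wordProd (r : FreeAlgebra ℂ X → FreeAlgebra ℂ X → Prop) {m : ℕ}
    (w : Fin m → X) : RingQuot r := ((List.ofFn w).map (gen r)).prod

theorem degPart_eq_span (r : FreeAlgebra ℂ X → FreeAlgebra ℂ X → Prop) (m : ℕ) :
    degPart r m = Submodule.span ℂ (Set.range (wordProd r (m := m))) := by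
  rw [degPart, Submodule.span_pow]
  congr 1
  ext a
  rw [Set.mem_pow]
  constructor
  · rintro ⟨f, rfl⟩
    choose g hg using fun i => (f i).2
    refine ⟨g, ?_⟩
    rw [wordProd, List.map_ofFn]
    congr 2
    funext i
    exact hg i
  · rintro ⟨w, rfl⟩
    exact ⟨fun i => ⟨gen r (w i), w i, rfl⟩, by rw [wordProd, List.map_ofFn]; rfl⟩

theorem wordProd_mem (r : FreeAlgebra ℂ X → FreeAlgebra ℂ X → Prop) {m : ℕ} (w : Fin m → X) :
    wordProd r w ∈ degPart r m := by
  rw [degPart_eq_span]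
  exact Submodule.subset_span ⟨w, rfl⟩

theorem ofFn_update_update [DecidableEq X] {m : ℕ} (w : Fin m → X) {s t : Fin m}
    (h : (s : ℕ) + 1 = t) (x y : X) :
    List.ofFn (Function.update (Function.update w s x) t y) =
      (List.ofFn w).take s ++ x :: y :: (List.ofFn w).drop (s + 2) := by
  have hs := s.2
  have ht := t.2
  apply List.ext_getElem
  · simp; omega
  · intro k h1 h2
    simp only [List.length_ofFn] at h1
    rw [List.getElem_ofFn, List.getElem_append]
    simp only [List.length_take, List.length_ofFn, List.getElem_take, List.getElem_ofFn,
      List.getElem_cons, List.getElem_drop, Function.update_apply, Fin.ext_iff]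
    have hmin : min (s : ℕ) m = s := by omega
    simp only [hmin]
    rcases lt_trichotomy k s with hk | hk | hk
    · rw [if_neg (by omega), if_neg (by omega), dif_pos hk]
    · subst hk
      rw [if_neg (by omega), if_pos rfl, dif_neg (by omega), dif_pos (by omega)]
    · rw [dif_neg (by omega), dif_neg (by omega)]
      by_cases hkt : k = t
      · rw [if_pos hkt, dif_pos (by omega)]
      · rw [if_neg hkt, if_neg (by omega), dif_neg (by omega)]
        congr 2
        omega

/-- Restriction of functionals on the degree `m` part to words. -/
noncomputable def dualToSol [Fintype X] [DecidableEq X]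
    (h : ∀ i, ∃ a b, r a b ∧
      a - b = ∑ x, ∑ y, c i x y • (FreeAlgebra.ι ℂ x * FreeAlgebra.ι ℂ y)) (m : ℕ) :
    Module.Dual ℂ (degPart r m) →ₗ[ℂ] quadSol c m where
  toFun ψ := ⟨fun w => ψ ⟨wordProd r w, wordProd_mem r w⟩, fun i s t hst w => by
    simp_rw [← smul_eq_mul, ← map_smul, ← map_sum]
    refine Eq.trans (congrArg ψ (Subtype.ext ?_)) (map_zero ψ)
    simp only [Submodule.coe_sum, Submodule.coe_smul, Submodule.coe_zero, wordProd]
    simp_rw [ofFn_update_update w hst]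
    obtain ⟨a, b, hab, hc⟩ := h i
    have hz : ∑ x, ∑ y, c i x y • (gen r x * gen r y) = 0 := by
      have := congrArg (RingQuot.mkAlgHom ℂ r) hc
      rw [map_sub, RingQuot.mkAlgHom_rel ℂ hab, sub_self] at this
      simp only [map_sum, map_smul, map_mul] at this
      exact this.symm
    have := congrArg (fun z => (((List.ofFn w).take s).map (gen r)).prod * z *
      (((List.ofFn w).drop (s + 2)).map (gen r)).prod) hz
    simpa [Finset.mul_sum, Finset.sum_mul, mul_assoc] using this⟩
  map_add' _ _ := rfl
  map_smul' _ _ := rfl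

/-- Extension by zero of functions on words of length `m`. -/
theorem exists_listSol [Fintype X] [DecidableEq X] {m : ℕ} (φ : quadSol c m) :
    ∃ φ' : listSol c, ∀ w : Fin m → X, φ'.1 (List.ofFn w) = φ.1 w := by
  refine ⟨⟨fun l => if h : l.length = m then φ.1 (fun k => l.get (k.cast h.symm)) else 0, ?_⟩, ?_⟩
  · intro i u v
    -- All terms of an inserted relation have the same length, so either all come from `φ` or all
    -- are zero.
    by_cases hl : u.length + (v.length + 2) = m
    swap
    · refine Finset.sum_eq_zero fun x _ => Finset.sum_eq_zero fun y _ => ?_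
      dsimp only
      rw [dif_neg (by simpa using hl), mul_zero]
    -- The letter `z` only fills the two slots that the updates overwrite; without letters the sum
    -- is empty.
    rcases isEmpty_or_nonempty X with hX | ⟨⟨z⟩⟩
    · simp
    subst hl
    have := φ.2 i ⟨u.length, by omega⟩ ⟨u.length + 1, by omega⟩ rfl
      (fun k => (u ++ z :: z :: v).get (k.cast (by simp)))
    refine Eq.trans (Finset.sum_congr rfl fun x _ => Finset.sum_congr rfl fun y _ => ?_) this
    dsimp only
    rw [dif_pos (by simp)]
    refine congrArg (c i x y * φ.1 ·) (List.ofFn_injective ?_)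
    rw [ofFn_update_update _ rfl]
    apply List.ext_getElem
    · simp
      omega
    · intro k h1 h2
      simp only [List.getElem_ofFn, List.get_eq_getElem, Fin.val_cast]
      simp only [List.getElem_append, List.length_take, List.length_ofFn, List.getElem_take,
        List.getElem_ofFn, List.getElem_cons,
        List.getElem_drop, le_add_iff_nonneg_right, zero_le, inf_of_le_left]
      split_ifs <;> first | rfl | omega | (congr 1; omega)
  · intro w
    simp

/-- A functional is determined by its values on words, since these span. Conversely, a solution
extended by zero to all lengths lies in a module on which the algebra acts by right translation, and
acting and then reading off the value at the empty word gives the functional. Here `h` makes the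
action well defined and `h'` makes functionals restrict to solutions. -/
theorem finrank_degPart [Fintype X] [DecidableEq X]
    (h : ∀ a b, r a b → ∃ i, a - b = ∑ x, ∑ y, c i x y • (FreeAlgebra.ι ℂ x * FreeAlgebra.ι ℂ y))
    (h' : ∀ i, ∃ a b, r a b ∧
      a - b = ∑ x, ∑ y, c i x y • (FreeAlgebra.ι ℂ x * FreeAlgebra.ι ℂ y)) (m : ℕ) :
    Module.finrank ℂ (degPart r m) = Module.finrank ℂ (quadSol c m) := by
  rw [← Subspace.dual_finrank_eq (V := degPart r m)]
  refine (LinearEquiv.ofBijective (dualToSol h' m) ⟨?_, ?_⟩).finrank_eq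
  · rw [← LinearMap.ker_eq_bot, LinearMap.ker_eq_bot']
    intro ψ hψ
    refine LinearMap.ext fun ⟨a, ha⟩ => ?_
    have hw : ∀ w, ψ ⟨wordProd r w, wordProd_mem r w⟩ = 0 := fun w =>
      congrFun (congrArg Subtype.val hψ) w
    have ha' := ha
    rw [degPart_eq_span] at ha'
    induction ha' using Submodule.span_induction with
    | mem a hmem => obtain ⟨w, rfl⟩ := hmem; exact hw w
    | zero => exact map_zero ψ
    | add a b ha' hb iha ihb =>
      rw [← degPart_eq_span] at ha' hb
      change ψ (⟨a, ha'⟩ + ⟨b, hb⟩) = 0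
      rw [map_add, iha ha', ihb hb]
      exact add_zero _
    | smul z a ha' iha =>
      rw [← degPart_eq_span] at ha'
      change ψ (z • ⟨a, ha'⟩) = 0
      rw [map_smul, iha ha']
      exact smul_zero _
  · intro φ
    obtain ⟨φ', hφ'⟩ := exists_listSol φ
    refine ⟨(LinearMap.proj (R := ℂ) (φ := fun _ : List X => ℂ) [] ∘ₗ (listSol c).subtype ∘ₗ
      LinearMap.applyₗ φ' ∘ₗ (actHom h).toLinearMap) ∘ₗ (degPart r m).subtype, ?_⟩
    refine Subtype.ext (funext fun w => ?_)
    change (actHom h (wordProd r w) φ').1 [] = _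
    rw [wordProd, actHom_list, List.nil_append, hφ']

end Duality

/-! ### Hecke operators and descents of words -/

/-- Operators `τ s (s+1)` satisfying the Hecke and braid relations. -/
structure IsHecke (q : ℂ) {m : ℕ} {M : Type} [AddCommGroup M] [Module ℂ M]
    (τ : Fin m → Fin m → M →ₗ[ℂ] M) : Prop where
  quad : ∀ s t : Fin m, (s : ℕ) + 1 = t → ∀ x, τ s t (τ s t x) = x + (q - q⁻¹) • τ s t x
  braid : ∀ s t u : Fin m, (s : ℕ) + 1 = t → (t : ℕ) + 1 = u → ∀ x,
    τ s t (τ t u (τ s t x)) = τ t u (τ s t (τ t u x))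
  comm : ∀ s t u v : Fin m, (s : ℕ) + 1 = t → (u : ℕ) + 1 = v → t < u → ∀ x,
    τ s t (τ u v x) = τ u v (τ s t x)

/-- A weight that decreases when a descent of a word is removed. -/
def wordWeight {m n : ℕ} (α : Fin m → Fin n) : ℕ := ∑ k, (m - k) * (α k : ℕ)

/-- The additive form avoids subtraction in ℕ. It serves both for `wordWeight` and for sums of
squares of letters. -/
theorem sum_swap_eq {m : ℕ} (g : Fin m → ℕ → ℕ) {n : ℕ} (α β : Fin m → Fin n) {s t : Fin m}
    (hst : s ≠ t) (h : ∀ k, k ≠ s → k ≠ t → β k = α k) :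
    ∑ k, g k (β k) + (g s (α s) + g t (α t)) = ∑ k, g k (α k) + (g s (β s) + g t (β t)) := by
  have key : ∀ γ : Fin m → Fin n, ∑ k, g k (γ k) =
      (g s (γ s) + g t (γ t)) + ∑ k ∈ Finset.univ \ {s, t}, g k (γ k) := by
    intro γ
    rw [← Finset.sum_pair (f := fun k => g k (γ k)) hst, add_comm, Finset.sum_sdiff (Finset.subset_univ _)]
  rw [key α, key β, Finset.sum_congr rfl (fun k hk => by
    simp only [Finset.mem_sdiff, Finset.mem_insert, Finset.mem_singleton, not_or] at hk
    rw [h k hk.2.1 hk.2.2])]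
  ring

theorem wordWeight_swap_lt {m n : ℕ} {α : Fin m → Fin n} {s t : Fin m} (hst : (s : ℕ) + 1 = t)
    (h : α t < α s) : wordWeight (α ∘ Equiv.swap s t) < wordWeight α := by
  have hne : s ≠ t := by rintro rfl; omega
  have := sum_swap_eq (fun k a => (m - k) * a) α (α ∘ Equiv.swap s t) hne (fun k h1 h2 => by
    simp [Equiv.swap_apply_of_ne_of_ne h1 h2])
  simp only [Function.comp_apply, Equiv.swap_apply_left, Equiv.swap_apply_right] at this
  unfold wordWeight
  have ht := t.2
  obtain ⟨d, hd⟩ : ∃ d, m - (t : ℕ) = d := ⟨_, rfl⟩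
  have hs : m - (s : ℕ) = d + 1 := by omega
  rw [hd, hs] at this
  have h' : (α t : ℕ) < α s := h
  simp only [Function.comp_apply]
  nlinarith

theorem exists_descent {m : ℕ} {L : Type*} [LinearOrder L] {α : Fin m → L} (h : ¬ Monotone α) :
    ∃ s t : Fin m, (s : ℕ) + 1 = t ∧ α t < α s := by
  cases m with
  | zero => exact absurd (fun a => a.elim0) h
  | succ m =>
    rw [Fin.monotone_iff_le_succ] at h
    push Not at h
    obtain ⟨i, hi⟩ := h
    exact ⟨i.castSucc, i.succ, by simp, hi⟩

/-! ### Sorting words by Hecke operators -/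

section SortFamily

variable {m n : ℕ} {q : ℂ} {M : Type} [AddCommGroup M] [Module ℂ M]

open Classical in
/-- The vectors obtained from the vectors `f λ` of sorted words by sorting a word along descents
and applying the corresponding operators. -/
noncomputable def sortFam (τ : Fin m → Fin m → M →ₗ[ℂ] M) (f : (Fin m → Fin n) → M)
    (α : Fin m → Fin n) : M :=
  if h : ∃ st : Fin m × Fin m, (st.1 : ℕ) + 1 = st.2 ∧ α st.2 < α st.1 then
    τ h.choose.1 h.choose.2 (sortFam τ f (α ∘ Equiv.swap h.choose.1 h.choose.2))
  else f α
termination_by wordWeight α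
decreasing_by exact wordWeight_swap_lt h.choose_spec.1 h.choose_spec.2

theorem sortFam_of_monotone (τ : Fin m → Fin m → M →ₗ[ℂ] M) (f : (Fin m → Fin n) → M)
    {α : Fin m → Fin n} (h : Monotone α) : sortFam τ f α = f α := by
  rw [sortFam, dif_neg]
  rintro ⟨⟨s, t⟩, h1, h2⟩
  exact absurd (h (show s ≤ t from Fin.le_def.2 (by simp at h1; omega))) (not_le.2 h2)

theorem sortFam_of_not_monotone (τ : Fin m → Fin m → M →ₗ[ℂ] M) (f : (Fin m → Fin n) → M)
    {α : Fin m → Fin n} (h : ¬ Monotone α) : ∃ s t : Fin m, (s : ℕ) + 1 = t ∧ α t < α s ∧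
      sortFam τ f α = τ s t (sortFam τ f (α ∘ Equiv.swap s t)) := by
  obtain ⟨s, t, h1, h2⟩ := exists_descent h
  have h' : ∃ st : Fin m × Fin m, (st.1 : ℕ) + 1 = st.2 ∧ α st.2 < α st.1 := ⟨(s, t), h1, h2⟩
  exact ⟨_, _, h'.choose_spec.1, h'.choose_spec.2, by rw [sortFam, dif_pos h']⟩

theorem comp_swap_swap_comm {L : Type*} (α : Fin m → L) {s t u v : Fin m}
    (h1 : s ≠ u) (h2 : s ≠ v) (h3 : t ≠ u) (h4 : t ≠ v) :
    (α ∘ Equiv.swap u v) ∘ Equiv.swap s t = (α ∘ Equiv.swap s t) ∘ Equiv.swap u v := by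
  funext k
  simp only [Function.comp_apply]
  congr 1
  simp only [Equiv.swap_apply_def]
  split_ifs <;> simp_all

theorem comp_swap_braid {L : Type*} (α : Fin m → L) {s t u : Fin m}
    (h1 : s ≠ t) (h2 : t ≠ u) (h3 : s ≠ u) :
    ((α ∘ Equiv.swap s t) ∘ Equiv.swap t u) ∘ Equiv.swap s t =
      ((α ∘ Equiv.swap t u) ∘ Equiv.swap s t) ∘ Equiv.swap t u := by
  funext k
  simp only [Function.comp_apply]
  congr 1
  simp only [Equiv.swap_apply_def]
  split_ifs <;> simp_all

/-- Confluence of sorting: two descents at disjoint positions are reconciled by commutation, two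
overlapping ones by the braid relation. The behaviour at ties is carried in the same induction; for
an unsorted word it is moved past a descent to a word of smaller weight. -/
theorem sortFam_spec {τ : Fin m → Fin m → M →ₗ[ℂ] M} (hτ : IsHecke q τ)
    {f : (Fin m → Fin n) → M}
    (hf : ∀ α, Monotone α → ∀ s t : Fin m, (s : ℕ) + 1 = t → α s = α t → τ s t (f α) = q • f α)
    (α : Fin m → Fin n) :
    (∀ s t : Fin m, (s : ℕ) + 1 = t → α t < α s →
      sortFam τ f α = τ s t (sortFam τ f (α ∘ Equiv.swap s t))) ∧
    (∀ s t : Fin m, (s : ℕ) + 1 = t → α s = α t →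
      τ s t (sortFam τ f α) = q • sortFam τ f α) := by
  induction hN : wordWeight α using Nat.strong_induction_on generalizing α with
  | _ N ih =>
  subst hN
  have IH : ∀ β : Fin m → Fin n, wordWeight β < wordWeight α → _ := fun β hβ => ih _ hβ β rfl
  clear ih
  -- two ways of sorting lead to the same vector
  have conf : ∀ s t u v : Fin m, (s : ℕ) + 1 = t → (u : ℕ) + 1 = v → s < u →
      α t < α s → α v < α u →
      τ s t (sortFam τ f (α ∘ Equiv.swap s t)) = τ u v (sortFam τ f (α ∘ Equiv.swap u v)) := by
    intro s t u v hst huv hsu h1 h2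
    have w1 := wordWeight_swap_lt hst h1
    have w2 := wordWeight_swap_lt huv h2
    have nst : s ≠ t := by rintro rfl; omega
    have nuv : u ≠ v := by rintro rfl; omega
    have nsu : s ≠ u := hsu.ne
    have nsv : s ≠ v := by rintro rfl; exact absurd (Fin.lt_def.1 hsu) (by omega)
    have ntv : t ≠ v := by rintro rfl; exact absurd (Fin.lt_def.1 hsu) (by omega)
    by_cases htu : t = u
    · subst htu
      have a1 : (α ∘ Equiv.swap s t) v < (α ∘ Equiv.swap s t) t := by
        simp [Equiv.swap_apply_of_ne_of_ne nsv.symm ntv.symm, h2.trans h1]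
      have a2 : ((α ∘ Equiv.swap s t) ∘ Equiv.swap t v) t <
          ((α ∘ Equiv.swap s t) ∘ Equiv.swap t v) s := by
        simp [Equiv.swap_apply_of_ne_of_ne nsv.symm ntv.symm,
          Equiv.swap_apply_of_ne_of_ne nst nsv, h2]
      have b1 : (α ∘ Equiv.swap t v) t < (α ∘ Equiv.swap t v) s := by
        simp [Equiv.swap_apply_of_ne_of_ne nst nsv, h2.trans h1]
      have b2 : ((α ∘ Equiv.swap t v) ∘ Equiv.swap s t) v <
          ((α ∘ Equiv.swap t v) ∘ Equiv.swap s t) t := by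
        simp [Equiv.swap_apply_of_ne_of_ne nst nsv,
          Equiv.swap_apply_of_ne_of_ne nsv.symm ntv.symm, h1]
      rw [(IH _ w1).1 t v huv a1, (IH _ ((wordWeight_swap_lt huv a1).trans w1)).1 s t hst a2,
        (IH _ w2).1 s t hst b1, (IH _ ((wordWeight_swap_lt hst b1).trans w2)).1 t v huv b2,
        comp_swap_braid α nst ntv nsv, hτ.braid s t v hst huv]
    · have a1 : (α ∘ Equiv.swap s t) v < (α ∘ Equiv.swap s t) u := by
        simp [Equiv.swap_apply_of_ne_of_ne nsv.symm ntv.symm,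
          Equiv.swap_apply_of_ne_of_ne nsu.symm (Ne.symm htu), h2]
      have b1 : (α ∘ Equiv.swap u v) t < (α ∘ Equiv.swap u v) s := by
        simp [Equiv.swap_apply_of_ne_of_ne nsu nsv, Equiv.swap_apply_of_ne_of_ne htu ntv, h1]
      rw [(IH _ w1).1 u v huv a1, (IH _ w2).1 s t hst b1,
        comp_swap_swap_comm α nsu nsv htu ntv, hτ.comm s t u v hst huv]
      rw [Fin.lt_def] at hsu ⊢
      have := Fin.val_ne_of_ne htu
      omega
  have first : ∀ s t : Fin m, (s : ℕ) + 1 = t → α t < α s →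
      sortFam τ f α = τ s t (sortFam τ f (α ∘ Equiv.swap s t)) := by
    intro s t hst h1
    have hα : ¬ Monotone α := fun h =>
      absurd (h (show s ≤ t from Fin.le_def.2 (by omega))) (not_le.2 h1)
    obtain ⟨u, v, huv, h2, he⟩ := sortFam_of_not_monotone τ f hα
    rw [he]
    rcases lt_trichotomy s u with h | rfl | h
    · exact (conf s t u v hst huv h h1 h2).symm
    · obtain rfl : t = v := Fin.ext (by omega)
      rfl
    · exact conf u v s t huv hst h h2 h1
  refine ⟨first, fun s t hst h1 => ?_⟩
  by_cases hα : Monotone α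
  · rw [sortFam_of_monotone τ f hα]
    exact hf α hα s t hst h1
  obtain ⟨u, v, huv, h2, he⟩ := sortFam_of_not_monotone τ f hα
  have w2 := wordWeight_swap_lt huv h2
  have nst : s ≠ t := by rintro rfl; omega
  have nuv : u ≠ v := by rintro rfl; omega
  have nsu : s ≠ u := by
    rintro rfl
    obtain rfl : t = v := Fin.ext (by omega)
    exact h2.ne h1.symm
  have ntv : t ≠ v := by
    rintro rfl
    exact nsu (Fin.ext (by omega))
  -- If the descent overlaps the tie, the braid relation carries the tie to the other pair of
  -- positions of a word sorted twice further.
  by_cases htu : t = u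
  · subst htu
    have nsv : s ≠ v := by rintro rfl; omega
    have b1 : (α ∘ Equiv.swap t v) t < (α ∘ Equiv.swap t v) s := by
      simp [Equiv.swap_apply_of_ne_of_ne nst nsv, h1, h2]
    have b2 : ((α ∘ Equiv.swap t v) ∘ Equiv.swap s t) t =
        ((α ∘ Equiv.swap t v) ∘ Equiv.swap s t) v := by
      simp [Equiv.swap_apply_of_ne_of_ne nst nsv,
        Equiv.swap_apply_of_ne_of_ne nsv.symm ntv.symm, h1]
    rw [he, (IH _ w2).1 s t hst b1, hτ.braid s t v hst huv,
      (IH _ ((wordWeight_swap_lt hst b1).trans w2)).2 t v huv b2, map_smul, map_smul]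
  by_cases hsv : s = v
  · subst hsv
    have nut : u ≠ t := Ne.symm htu
    have b1 : (α ∘ Equiv.swap u s) t < (α ∘ Equiv.swap u s) s := by
      simp [Equiv.swap_apply_of_ne_of_ne nut.symm nst.symm, ← h1, h2]
    have b2 : ((α ∘ Equiv.swap u s) ∘ Equiv.swap s t) u =
        ((α ∘ Equiv.swap u s) ∘ Equiv.swap s t) s := by
      simp [Equiv.swap_apply_of_ne_of_ne nut.symm nst.symm,
        Equiv.swap_apply_of_ne_of_ne nsu.symm nut, h1]
    rw [he, (IH _ w2).1 s t hst b1, ← hτ.braid u s t huv hst,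
      (IH _ ((wordWeight_swap_lt hst b1).trans w2)).2 u s huv b2, map_smul, map_smul]
  · have b1 : (α ∘ Equiv.swap u v) s = (α ∘ Equiv.swap u v) t := by
      simp [Equiv.swap_apply_of_ne_of_ne nsu hsv, Equiv.swap_apply_of_ne_of_ne htu ntv, h1]
    have hc : ∀ x, τ s t (τ u v x) = τ u v (τ s t x) := by
      intro x
      rcases lt_trichotomy t u with h | h | h
      · exact hτ.comm s t u v hst huv h x
      · exact absurd h htu
      · refine (hτ.comm u v s t huv hst ?_ x).symm
        have h3 := Fin.val_ne_of_ne hsv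
        have h4 := Fin.val_ne_of_ne nsu
        rw [Fin.lt_def] at h ⊢
        omega
    rw [he, hc, (IH _ w2).2 s t hst b1, map_smul]

theorem sortFam_ascent {τ : Fin m → Fin m → M →ₗ[ℂ] M} (hτ : IsHecke q τ)
    {f : (Fin m → Fin n) → M}
    (hf : ∀ α, Monotone α → ∀ s t : Fin m, (s : ℕ) + 1 = t → α s = α t → τ s t (f α) = q • f α)
    {α : Fin m → Fin n} {s t : Fin m} (hst : (s : ℕ) + 1 = t) (h : α s < α t) :
    τ s t (sortFam τ f α) = sortFam τ f (α ∘ Equiv.swap s t) := by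
  rw [(sortFam_spec hτ hf (α ∘ Equiv.swap s t)).1 s t hst (by simpa using h),
    Function.comp_assoc, ← Equiv.coe_trans, Equiv.swap_swap, Equiv.coe_refl, Function.comp_id]

theorem sortFam_descent {τ : Fin m → Fin m → M →ₗ[ℂ] M} (hτ : IsHecke q τ)
    {f : (Fin m → Fin n) → M}
    (hf : ∀ α, Monotone α → ∀ s t : Fin m, (s : ℕ) + 1 = t → α s = α t → τ s t (f α) = q • f α)
    {α : Fin m → Fin n} {s t : Fin m} (hst : (s : ℕ) + 1 = t) (h : α t < α s) :
    τ s t (sortFam τ f α) =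
      sortFam τ f (α ∘ Equiv.swap s t) + (q - q⁻¹) • sortFam τ f α := by
  rw [(sortFam_spec hτ hf α).1 s t hst h, hτ.quad s t hst]

end SortFamily

/-! ### Demazure-Lusztig identities over a field -/

section DemazureIdentities

/-- Here `κ` stands for q - q⁻¹, `a` and `b` for the variables x_s and x_t, the index 1 for their
swap, and `g`, `h` for Tf and T²f. Each hypothesis is the defining equation of T, or its image under
the swap, with the denominator cleared. -/
theorem demazure_quad_field {K : Type*} [Field K] {q κ a b f f₁ g g₁ h : K}
    (hκ : q * κ = q ^ 2 - 1) (hq : q ≠ 0) (hab : b - a ≠ 0)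
    (e₁ : (b - a) * g = q * ((b - a) * f₁) + κ * (b * (f - f₁)))
    (e₂ : (a - b) * g₁ = q * ((a - b) * f) + κ * (a * (f₁ - f)))
    (e₃ : (b - a) * h = q * ((b - a) * g₁) + κ * (b * (g - g₁))) :
    h = f + κ * g := by
  have hab' : a - b ≠ 0 := by rw [← neg_sub]; exact neg_ne_zero.2 hab
  obtain rfl : κ = (q ^ 2 - 1) / q := by field_simp; linear_combination hκ
  obtain rfl : g = (q * ((b - a) * f₁) + (q ^ 2 - 1) / q * (b * (f - f₁))) / (b - a) := by
    rw [← e₁]; field_simp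
  obtain rfl : g₁ = -(q * ((a - b) * f) + (q ^ 2 - 1) / q * (a * (f₁ - f))) / (b - a) := by
    rw [← e₂]; field_simp; ring
  refine mul_left_cancel₀ hab (e₃.trans ?_)
  field_simp
  ring

theorem demazure_comm_field {K : Type*} [Field K]
    {q κ a b c d f f₁ f₂ f₁₂ g g₂ g' g₁' h h' : K}
    (hab : b - a ≠ 0) (hcd : d - c ≠ 0)
    (e₁ : (b - a) * g = q * ((b - a) * f₁) + κ * (b * (f - f₁)))
    (e₂ : (b - a) * g₂ = q * ((b - a) * f₁₂) + κ * (b * (f₂ - f₁₂)))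
    (e₃ : (d - c) * h = q * ((d - c) * g₂) + κ * (d * (g - g₂)))
    (e₁' : (d - c) * g' = q * ((d - c) * f₂) + κ * (d * (f - f₂)))
    (e₂' : (d - c) * g₁' = q * ((d - c) * f₁₂) + κ * (d * (f₁ - f₁₂)))
    (e₃' : (b - a) * h' = q * ((b - a) * g₁') + κ * (b * (g' - g₁'))) :
    h = h' := by
  refine mul_left_cancel₀ (mul_ne_zero hab hcd) ?_
  linear_combination (b - a) * e₃ - (d - c) * e₃' + q * (d - c) * e₂ + κ * d * (e₁ - e₂) -
    q * (b - a) * e₂' - κ * b * (e₁' - e₂')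

/-- Index strings are products of the two adjacent swaps, 1 for (s t) and 2 for (t u). The unprimed
equations compute T₁T₂T₁f and the primed ones T₂T₁T₂f, both from the six permuted copies of `f`. -/
theorem demazure_braid_field {K : Type*} [Field K]
    {q κ a b c f f₁ f₂ f₁₂ f₂₁ f₁₂₁ g g₁ g₂ g₁₂ h h₁ k g' g₁' g₂' g₂₁' h' h₂' k' : K}
    (hκ : q * κ = q ^ 2 - 1) (hq : q ≠ 0)
    (hab : b - a ≠ 0) (hbc : c - b ≠ 0) (hac : c - a ≠ 0)
    (e₁ : (b - a) * g = q * ((b - a) * f₁) + κ * (b * (f - f₁)))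
    (e₂ : (c - a) * g₂ = q * ((c - a) * f₂₁) + κ * (c * (f₂ - f₂₁)))
    (e₃ : (a - b) * g₁ = q * ((a - b) * f) + κ * (a * (f₁ - f)))
    (e₄ : (c - b) * g₁₂ = q * ((c - b) * f₁₂₁) + κ * (c * (f₁₂ - f₁₂₁)))
    (e₅ : (c - b) * h = q * ((c - b) * g₂) + κ * (c * (g - g₂)))
    (e₆ : (c - a) * h₁ = q * ((c - a) * g₁₂) + κ * (c * (g₁ - g₁₂)))
    (e₇ : (b - a) * k = q * ((b - a) * h₁) + κ * (b * (h - h₁)))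
    (e₁' : (c - b) * g' = q * ((c - b) * f₂) + κ * (c * (f - f₂)))
    (e₂' : (c - a) * g₁' = q * ((c - a) * f₁₂) + κ * (c * (f₁ - f₁₂)))
    (e₃' : (b - c) * g₂' = q * ((b - c) * f) + κ * (b * (f₂ - f)))
    (e₄' : (b - a) * g₂₁' = q * ((b - a) * f₁₂₁) + κ * (b * (f₂₁ - f₁₂₁)))
    (e₅' : (b - a) * h' = q * ((b - a) * g₁') + κ * (b * (g' - g₁')))
    (e₆' : (c - a) * h₂' = q * ((c - a) * g₂₁') + κ * (c * (g₂' - g₂₁')))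
    (e₇' : (c - b) * k' = q * ((c - b) * h₂') + κ * (c * (h' - h₂'))) :
    k = k' := by
  have hab' : a - b ≠ 0 := by rw [← neg_sub]; exact neg_ne_zero.2 hab
  have hbc' : b - c ≠ 0 := by rw [← neg_sub]; exact neg_ne_zero.2 hbc
  obtain rfl : κ = (q ^ 2 - 1) / q := by field_simp; linear_combination hκ
  have r : ∀ {x y z : K}, x ≠ 0 → x * y = z → y = z / x := fun hx hy => by
    rw [← hy, mul_div_cancel_left₀ _ hx]
  have n₃ : (b - a) * g₁ = -(q * ((a - b) * f) + (q ^ 2 - 1) / q * (a * (f₁ - f))) := by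
    rw [← e₃]; ring
  have n₃' : (c - b) * g₂' = -(q * ((b - c) * f) + (q ^ 2 - 1) / q * (b * (f₂ - f))) := by
    rw [← e₃']; ring
  rw [r hab e₇, r hbc e₇', r hac e₆, r hbc e₅, r hac e₆', r hab e₅', r hab e₁, r hac e₂,
    r hab n₃, r hbc e₄, r hbc e₁', r hac e₂', r hbc n₃', r hab e₄']
  field_simp
  ring

end DemazureIdentities

/-! ### The matrix R as a divided difference -/

theorem R_one_eq {n : ℕ} {q : ℂ} (i j k l : Fin n) :
    R n q 1 i j k l = if (k : ℕ) + l = i + j then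
      (if (k : ℕ) = i then q else 0) + (q - q⁻¹) *
        -- The second range includes k = i, so that the diagonal entry for i < j comes out as q - (q
        -- - q⁻¹) = q⁻¹.
        ((if (j : ℕ) ≤ k ∧ (k : ℕ) < i then 1 else 0) -
          (if (i : ℕ) ≤ k ∧ (k : ℕ) < j then 1 else 0)) else 0 := by
  simp only [R, Fin.ext_iff, Fin.le_def, Fin.lt_def, inv_one, one_zpow, mul_one, one_mul]
  split_ifs <;> first | omega | ring

theorem p_mul_R {n : ℕ} {q p : ℂ} (hp : p ≠ 0) (i j k l : Fin n) :
    p * R n q p i j k l = p ^ (2 * ((l : ℤ) - (i : ℤ))) * R n q 1 i j k l := by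
  simp only [R, inv_one, one_zpow, mul_one, one_mul, mul_inv_cancel_left₀ hp]
  split_ifs <;> ring

theorem sum_R_one {n : ℕ} {q : ℂ} {N : Type*} [AddCommGroup N] [Module ℂ N] (F : ℕ → ℕ → N)
    (i j : Fin n) :
    ∑ k : Fin n, ∑ l : Fin n, R n q 1 i j k l • F k l = q • F i j +
      (q - q⁻¹) • (∑ k ∈ Finset.Ico (j : ℕ) i, F k (i + j - k) -
        ∑ k ∈ Finset.Ico (i : ℕ) j, F k (i + j - k)) := by
  have hi := i.2
  have hj := j.2
  have h1 : ∀ k : Fin n, ∑ l : Fin n, R n q 1 i j k l • F k l =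
      (if (k : ℕ) = i then q else 0) • F k (i + j - k) + (q - q⁻¹) •
        ((if (j : ℕ) ≤ k ∧ (k : ℕ) < i then F k (i + j - k) else 0) -
          (if (i : ℕ) ≤ k ∧ (k : ℕ) < j then F k (i + j - k) else 0)) := by
    intro k
    have hk := k.2
    by_cases h : (k : ℕ) ≤ i + j ∧ (i : ℕ) + j - k < n
    · rw [Finset.sum_eq_single ⟨i + j - k, h.2⟩]
      · rw [R_one_eq, if_pos (by simp only []; omega), add_smul, mul_smul]
        congr 2
        simp only [sub_smul, ite_smul, one_smul, zero_smul]
      · intro l _ hl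
        rw [R_one_eq, if_neg, zero_smul]
        intro h'
        exact hl (Fin.ext (by simp only []; omega))
      · simp
    · rw [if_neg (by omega), if_neg (by omega), if_neg (by omega), zero_smul, sub_zero, smul_zero,
        add_zero]
      refine Finset.sum_eq_zero fun l _ => ?_
      have hl := l.2
      rw [R_one_eq, if_neg (by omega), zero_smul]
  simp_rw [h1]
  rw [Finset.sum_add_distrib, ← Finset.smul_sum, Finset.sum_sub_distrib]
  congr 1
  · rw [Finset.sum_eq_single i]
    · simp
    · intro k _ hk
      rw [if_neg (fun h => hk (Fin.ext h)), zero_smul]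
    · simp
  · have hs : ∀ a b : ℕ, b < n → ∑ k : Fin n, (if a ≤ (k : ℕ) ∧ (k : ℕ) < b then
        F k (i + j - k) else 0) = ∑ k ∈ Finset.Ico a b, F k (i + j - k) := by
      intro a b hb
      rw [Fin.sum_univ_eq_sum_range (fun k => if a ≤ k ∧ k < b then F k (i + j - k) else 0) n,
        ← Finset.sum_filter]
      congr 1
      ext k
      simp only [Finset.mem_filter, Finset.mem_range, Finset.mem_Ico]
      omega
    rw [hs _ _ hi, hs _ _ hj]

/-- A geometric sum. Through it the part of R carrying the factor q - q⁻¹ becomes a divided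
difference of monomials. -/
theorem sub_mul_sum_Ico {B : Type*} [CommRing B] (u v : B) {i j : ℕ} (h : j ≤ i) :
    (v - u) * ∑ k ∈ Finset.Ico j i, u ^ k * v ^ (i + j - k) =
      v * (u ^ j * v ^ i - u ^ i * v ^ j) := by
  obtain ⟨d, rfl⟩ := Nat.exists_eq_add_of_le h
  rw [Finset.sum_Ico_eq_sum_range, add_tsub_cancel_left]
  have : ∀ e ∈ Finset.range d, u ^ (j + e) * v ^ (j + d + j - (j + e)) =
      u ^ j * v ^ j * v * (u ^ e * v ^ (d - 1 - e)) := by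
    intro e he
    have he' := Finset.mem_range.1 he
    rw [show j + d + j - (j + e) = j + 1 + (d - 1 - e) by omega]
    ring
  rw [Finset.sum_congr rfl this, ← Finset.mul_sum]
  have := (Commute.all u v).geom_sum₂_mul d
  linear_combination (-(u ^ j * v ^ j * v)) * this

theorem sub_mul_sum_R_one {n : ℕ} {q : ℂ} {B : Type*} [CommRing B] [Algebra ℂ B] (u v : B)
    (i j : Fin n) :
    (v - u) * ∑ k : Fin n, ∑ l : Fin n, R n q 1 i j k l • (u ^ (k : ℕ) * v ^ (l : ℕ)) =
      q • ((v - u) * (u ^ (i : ℕ) * v ^ (j : ℕ))) + (q - q⁻¹) • (v *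
        (u ^ (j : ℕ) * v ^ (i : ℕ) - u ^ (i : ℕ) * v ^ (j : ℕ))) := by
  rw [sum_R_one (fun k l => u ^ k * v ^ l), mul_add, mul_smul_comm, mul_smul_comm, mul_sub]
  congr 2
  rcases le_total (j : ℕ) i with h | h
  · rw [Finset.Ico_eq_empty_of_le h, Finset.sum_empty, sub_mul_sum_Ico u v h]
    ring
  · rw [Finset.Ico_eq_empty_of_le h, Finset.sum_empty, add_comm (i : ℕ), sub_mul_sum_Ico u v h]
    ring

/-! ### The braid operators on polynomials -/

section BraidOp

variable {m n : ℕ} {q p : ℂ}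

/-- The Cremmer-Gervais operator at two tensor positions, composed with the flip. -/
noncomputable def braidOp (q p : ℂ) (s t : Fin m) :
    ((Fin m → Fin n) →₀ ℂ) →ₗ[ℂ] ((Fin m → Fin n) →₀ ℂ) :=
  Finsupp.linearCombination ℂ fun α => ∑ k, ∑ l, (p * R n q p (α t) (α s) k l) •
    Finsupp.single (Function.update (Function.update α s k) t l) 1

theorem braidOp_single (s t : Fin m) (α : Fin m → Fin n) :
    braidOp q p s t (Finsupp.single α 1) = ∑ k, ∑ l, (p * R n q p (α t) (α s) k l) •
      Finsupp.single (Function.update (Function.update α s k) t l) 1 := by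
  rw [braidOp, Finsupp.linearCombination_single, one_smul]

open MvPolynomial in
/-- The monomial of a word, with the `k`th variable rescaled by `p ^ (-2 k)`. -/
noncomputable def wordMonomial (p : ℂ) (α : Fin m → Fin n) : MvPolynomial (Fin m) ℂ :=
  ∏ k : Fin m, (C (p ^ (-2 * (k : ℤ))) * X k) ^ (α k : ℕ)

/-- The embedding of the tensor power into polynomials. -/
noncomputable def toPoly (p : ℂ) : ((Fin m → Fin n) →₀ ℂ) →ₗ[ℂ] MvPolynomial (Fin m) ℂ :=
  Finsupp.linearCombination ℂ (wordMonomial p)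

theorem toPoly_single (α : Fin m → Fin n) :
    toPoly p (Finsupp.single α 1) = wordMonomial p α := by
  rw [toPoly, Finsupp.linearCombination_single, one_smul]

open MvPolynomial in
theorem wordMonomial_update (p : ℂ) (α : Fin m → Fin n) {s t : Fin m} (h : s ≠ t)
    (k l : Fin n) :
    wordMonomial p (Function.update (Function.update α s k) t l) =
      (C (p ^ (-2 * (s : ℤ))) * X s) ^ (k : ℕ) * (C (p ^ (-2 * (t : ℤ))) * X t) ^ (l : ℕ) *
      ∏ a ∈ Finset.univ \ {s, t}, (C (p ^ (-2 * (a : ℤ))) * X a) ^ (α a : ℕ) := by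
  rw [wordMonomial, ← Finset.prod_sdiff (Finset.subset_univ {s, t}), Finset.prod_pair h,
    Function.update_self, Function.update_of_ne h, Function.update_self, mul_comm]
  congr 1
  refine Finset.prod_congr rfl fun a ha => ?_
  simp only [Finset.mem_sdiff, Finset.mem_insert, Finset.mem_singleton, not_or] at ha
  rw [Function.update_of_ne ha.2.2, Function.update_of_ne ha.2.1]

open MvPolynomial in
theorem toPoly_braidOp (hp : p ≠ 0) {s t : Fin m} (hst : (s : ℕ) + 1 = t)
    (f : (Fin m → Fin n) →₀ ℂ) :
    (X t - X s) * toPoly p (braidOp q p s t f) =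
      C q * ((X t - X s) * rename (Equiv.swap s t) (toPoly p f)) +
      C (q - q⁻¹) * (X t * (toPoly p f - rename (Equiv.swap s t) (toPoly p f))) := by
  induction f using Finsupp.induction_linear with
  | zero => simp
  | add f g hf hg =>
    simp only [map_add]
    linear_combination hf + hg
  | single α a =>
    rw [show Finsupp.single α a = a • Finsupp.single α (1 : ℂ) by simp]
    simp only [map_smul, mul_smul_comm, ← smul_sub, ← smul_add]
    congr 1
    have hne : s ≠ t := by rintro rfl; omega
    rw [braidOp_single, map_sum]
    simp only [map_sum, map_smul, toPoly_single]
    set P : MvPolynomial (Fin m) ℂ :=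
      ∏ a ∈ Finset.univ \ {s, t}, (C (p ^ (-2 * (a : ℤ))) * X a) ^ (α a : ℕ) with hP
    -- As t = s + 1 and k + l is fixed, the rescaling p^(-2sk - 2tl) depends on k, l only through
    -- p^(-2l), which cancels the p^(2l) in pR. The common factor left over is `c`, also the scale
    -- of the monomial of `α` itself.
    set c : ℂ := p ^ (-2 * (s : ℤ) * ((α t : ℤ) + α s) - 2 * (α t : ℤ)) with hc
    have hα : wordMonomial p α = c • (X s ^ (α s : ℕ) * X t ^ (α t : ℕ)) * P := by
      have := wordMonomial_update p α hne (α s) (α t)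
      rw [Function.update_eq_self, Function.update_eq_self] at this
      rw [this, mul_pow, mul_pow, ← C_pow, ← C_pow, ← hP, smul_eq_C_mul, hc]
      have : p ^ (-2 * (s : ℤ) * ((α t : ℤ) + α s) - 2 * (α t : ℤ)) =
          (p ^ (-2 * (s : ℤ))) ^ (α s : ℕ) * (p ^ (-2 * (t : ℤ))) ^ (α t : ℕ) := by
        rw [← zpow_natCast, ← zpow_natCast, ← zpow_mul, ← zpow_mul, ← zpow_add₀ hp, ← hst]
        congr 1
        push_cast
        ring
      rw [this, C_mul]
      ring
    have hren : rename (Equiv.swap s t) P = P := by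
      rw [hP, map_prod]
      refine Finset.prod_congr rfl fun a ha => ?_
      simp only [Finset.mem_sdiff, Finset.mem_insert, Finset.mem_singleton, not_or] at ha
      rw [map_pow, map_mul, rename_C, rename_X, Equiv.swap_apply_of_ne_of_ne ha.2.1 ha.2.2]
    have hterm : ∀ k l : Fin n, (p * R n q p (α t) (α s) k l) •
        wordMonomial p (Function.update (Function.update α s k) t l) =
        c • (R n q 1 (α t) (α s) k l • (X s ^ (k : ℕ) * X t ^ (l : ℕ))) * P := by
      intro k l
      by_cases hkl : (k : ℕ) + l = α t + α s
      · rw [wordMonomial_update p α hne, p_mul_R hp, mul_pow, mul_pow, ← C_pow, ← C_pow, ← hP, hc]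
        simp only [smul_eq_C_mul]
        have : p ^ (-2 * (s : ℤ) * ((α t : ℤ) + α s) - 2 * (α t : ℤ)) =
            p ^ (2 * ((l : ℤ) - (α t : ℤ))) *
              ((p ^ (-2 * (s : ℤ))) ^ (k : ℕ) * (p ^ (-2 * (t : ℤ))) ^ (l : ℕ)) := by
          rw [← zpow_natCast, ← zpow_natCast, ← zpow_mul, ← zpow_mul, ← zpow_add₀ hp,
            ← zpow_add₀ hp, ← hst]
          congr 1
          have : (k : ℤ) + l = α t + α s := by exact_mod_cast hkl
          push_cast
          linear_combination (2 * (s : ℤ)) * this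
        rw [this]
        simp only [C_mul]
        ring
      · rw [p_mul_R hp, R_one_eq, if_neg hkl]
        simp
    simp_rw [hterm, ← Finset.sum_mul, ← Finset.smul_sum]
    rw [hα, map_mul, hren, map_smul, map_mul, map_pow, map_pow, rename_X, rename_X,
      Equiv.swap_apply_left, Equiv.swap_apply_right]
    have := sub_mul_sum_R_one (q := q) (X s : MvPolynomial (Fin m) ℂ) (X t) (α t) (α s)
    simp only [smul_eq_C_mul] at this ⊢
    linear_combination (C c * P) * this

end BraidOp

/-! ### Hecke relations and the q-eigenspaces -/

section BraidOpHecke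

variable {m n : ℕ} {q p : ℂ}

open MvPolynomial in
theorem toPoly_injective (hp : p ≠ 0) :
    Function.Injective (toPoly p : ((Fin m → Fin n) →₀ ℂ) → MvPolynomial (Fin m) ℂ) := by
  have h1 : LinearIndependent ℂ fun α : Fin m → Fin n =>
      (monomial (Finsupp.equivFunOnFinite.symm fun k => (α k : ℕ)) (1 : ℂ)) := by
    have := (basisMonomials (Fin m) ℂ).linearIndependent.comp
      (fun α : Fin m → Fin n => Finsupp.equivFunOnFinite.symm fun k => (α k : ℕ)) (fun α β h => by
        funext k
        exact Fin.ext (congrFun (Finsupp.equivFunOnFinite.symm.injective h) k))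
    rw [coe_basisMonomials] at this
    exact this
  have h2 : wordMonomial p = fun α : Fin m → Fin n =>
      (∏ k : Fin m, (Units.mk0 p hp ^ (-2 * (k : ℤ))) ^ (α k : ℕ)) •
        (monomial (Finsupp.equivFunOnFinite.symm fun k => (α k : ℕ)) (1 : ℂ)) := by
    funext α
    rw [wordMonomial, Units.smul_def, smul_eq_C_mul, monomial_eq, C_1, one_mul,
      Finsupp.prod_fintype _ _ (fun i => pow_zero _)]
    simp only [mul_pow, Finset.prod_mul_distrib, Units.coe_prod, map_prod, Units.val_pow_eq_pow_val,
      Units.val_zpow_eq_zpow_val, Units.val_mk0, C_pow, Finsupp.equivFunOnFinite_symm_apply_apply]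
  rw [toPoly, h2]
  exact h1.units_smul _

/-- The image of a permuted tensor in the field of rational functions. -/
noncomputable def toFrac (p : ℂ) (ρ : Equiv.Perm (Fin m)) (f : (Fin m → Fin n) →₀ ℂ) :
    FractionRing (MvPolynomial (Fin m) ℂ) :=
  algebraMap _ _ (MvPolynomial.rename ρ (toPoly p f))

/-- The variables in the field of rational functions. -/
noncomputable def fracVar (k : Fin m) : FractionRing (MvPolynomial (Fin m) ℂ) :=
  algebraMap (MvPolynomial (Fin m) ℂ) _ (MvPolynomial.X k)

/-- The constants in the field of rational functions. -/
noncomputable def fracConst (m : ℕ) (c : ℂ) : FractionRing (MvPolynomial (Fin m) ℂ) :=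
  algebraMap (MvPolynomial (Fin m) ℂ) _ (MvPolynomial.C c)

theorem toFrac_one_injective (hp : p ≠ 0) :
    Function.Injective (toFrac p 1 : ((Fin m → Fin n) →₀ ℂ) → _) := by
  intro f g h
  have := IsFractionRing.injective (MvPolynomial (Fin m) ℂ)
    (FractionRing (MvPolynomial (Fin m) ℂ)) h
  rw [Equiv.Perm.coe_one, MvPolynomial.rename_id_apply, MvPolynomial.rename_id_apply] at this
  exact toPoly_injective hp this

theorem fracVar_sub_ne_zero {s t : Fin m} (h : s ≠ t) : fracVar t - fracVar s ≠ 0 := by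
  rw [sub_ne_zero]
  intro h'
  exact h (MvPolynomial.X_injective (R := ℂ)
    (IsFractionRing.injective (MvPolynomial (Fin m) ℂ) _ h')).symm

theorem fracConst_ne_zero {c : ℂ} (h : c ≠ 0) : fracConst m c ≠ 0 := by
  rw [fracConst, Ne, map_eq_zero_iff _ (IsFractionRing.injective (MvPolynomial (Fin m) ℂ) _),
    MvPolynomial.C_eq_zero]
  exact h

theorem fracConst_mul (hq : q ≠ 0) :
    fracConst m q * fracConst m (q - q⁻¹) = fracConst m q ^ 2 - 1 := by
  simp only [fracConst]
  rw [← map_mul, ← map_pow, ← map_one (algebraMap (MvPolynomial (Fin m) ℂ) _), ← map_sub,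
    ← MvPolynomial.C_mul, ← MvPolynomial.C_pow, ← MvPolynomial.C_1, ← MvPolynomial.C_sub]
  congr 2
  field_simp

/-- The permutation `ρ` is needed because iterating the operator involves permuted images of its own
output. -/
theorem toFrac_braidOp (hp : p ≠ 0) {s t : Fin m} (hst : (s : ℕ) + 1 = t)
    (ρ : Equiv.Perm (Fin m)) (f : (Fin m → Fin n) →₀ ℂ) :
    (fracVar (ρ t) - fracVar (ρ s)) * toFrac p ρ (braidOp q p s t f) =
      fracConst m q * ((fracVar (ρ t) - fracVar (ρ s)) * toFrac p (ρ * Equiv.swap s t) f) +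
      fracConst m (q - q⁻¹) * (fracVar (ρ t) *
        (toFrac p ρ f - toFrac p (ρ * Equiv.swap s t) f)) := by
  have := congrArg (fun z => algebraMap _ (FractionRing (MvPolynomial (Fin m) ℂ))
    (MvPolynomial.rename ρ z)) (toPoly_braidOp (q := q) hp hst f)
  simp only [map_mul, map_sub, map_add, MvPolynomial.rename_X, MvPolynomial.rename_C,
    MvPolynomial.rename_rename, ← Equiv.Perm.coe_mul] at this
  simpa only [toFrac, fracVar, fracConst, map_sub] using this

theorem toFrac_add_smul (ρ : Equiv.Perm (Fin m)) (c : ℂ) (f g : (Fin m → Fin n) →₀ ℂ) :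
    toFrac p ρ (f + c • g) = toFrac p ρ f + fracConst m c * toFrac p ρ g := by
  simp only [toFrac, fracConst, map_add, map_smul, MvPolynomial.smul_eq_C_mul, map_mul,
    MvPolynomial.rename_C]

theorem isHecke_braidOp (hq : q ≠ 0) (hp : p ≠ 0) :
    IsHecke q (braidOp q p : Fin m → Fin m → ((Fin m → Fin n) →₀ ℂ) →ₗ[ℂ] _) where
  quad s t hst f := by
    have hne : s ≠ t := by rintro rfl; omega
    apply toFrac_one_injective hp
    rw [toFrac_add_smul]
    have e₁ := toFrac_braidOp (q := q) hp hst 1 f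
    have e₂ := toFrac_braidOp (q := q) hp hst (Equiv.swap s t) f
    have e₃ := toFrac_braidOp (q := q) hp hst 1 (braidOp q p s t f)
    simp only [Equiv.Perm.coe_one, id_eq, one_mul, Equiv.swap_apply_left, Equiv.swap_apply_right,
      Equiv.swap_mul_self] at e₁ e₂ e₃
    exact demazure_quad_field (fracConst_mul hq) (fracConst_ne_zero hq) (fracVar_sub_ne_zero hne)
      e₁ e₂ e₃
  braid s t u hst htu f := by
    have nst : s ≠ t := by rintro rfl; omega
    have ntu : t ≠ u := by rintro rfl; omega
    have nsu : s ≠ u := by rintro rfl; omega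
    have hbr : Equiv.swap t u * Equiv.swap s t * Equiv.swap t u =
        Equiv.swap s t * Equiv.swap t u * Equiv.swap s t := by
      ext k
      simp only [Equiv.Perm.mul_apply, Equiv.swap_apply_def]
      split_ifs <;> simp_all
    apply toFrac_one_injective hp
    have e₁ := toFrac_braidOp (q := q) hp hst 1 f
    have e₂ := toFrac_braidOp (q := q) hp hst (Equiv.swap t u) f
    have e₃ := toFrac_braidOp (q := q) hp hst (Equiv.swap s t) f
    have e₄ := toFrac_braidOp (q := q) hp hst (Equiv.swap s t * Equiv.swap t u) f
    have e₅ := toFrac_braidOp (q := q) hp htu 1 (braidOp q p s t f)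
    have e₆ := toFrac_braidOp (q := q) hp htu (Equiv.swap s t) (braidOp q p s t f)
    have e₇ := toFrac_braidOp (q := q) hp hst 1 (braidOp q p t u (braidOp q p s t f))
    have e₁' := toFrac_braidOp (q := q) hp htu 1 f
    have e₂' := toFrac_braidOp (q := q) hp htu (Equiv.swap s t) f
    have e₃' := toFrac_braidOp (q := q) hp htu (Equiv.swap t u) f
    have e₄' := toFrac_braidOp (q := q) hp htu (Equiv.swap t u * Equiv.swap s t) f
    have e₅' := toFrac_braidOp (q := q) hp hst 1 (braidOp q p t u f)
    have e₆' := toFrac_braidOp (q := q) hp hst (Equiv.swap t u) (braidOp q p t u f)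
    have e₇' := toFrac_braidOp (q := q) hp htu 1 (braidOp q p s t (braidOp q p t u f))
    rw [hbr] at e₄'
    simp only [Equiv.Perm.coe_one, id_eq, one_mul, Equiv.Perm.mul_apply, Equiv.swap_apply_left,
      Equiv.swap_apply_right, Equiv.swap_mul_self, Equiv.swap_apply_of_ne_of_ne nst nsu,
      Equiv.swap_apply_of_ne_of_ne nsu.symm ntu.symm]
      at e₁ e₂ e₃ e₄ e₅ e₆ e₇ e₁' e₂' e₃' e₄' e₅' e₆' e₇'
    exact demazure_braid_field (fracConst_mul hq) (fracConst_ne_zero hq)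
      (fracVar_sub_ne_zero nst) (fracVar_sub_ne_zero ntu) (fracVar_sub_ne_zero nsu)
      e₁ e₂ e₃ e₄ e₅ e₆ e₇ e₁' e₂' e₃' e₄' e₅' e₆' e₇'
  comm s t u v hst huv htu f := by
    have h := Fin.lt_def.1 htu
    have nst : s ≠ t := by rintro rfl; omega
    have nuv : u ≠ v := by rintro rfl; omega
    have nsu : s ≠ u := by rintro rfl; omega
    have nsv : s ≠ v := by rintro rfl; omega
    have ntu : t ≠ u := by rintro rfl; omega
    have ntv : t ≠ v := by rintro rfl; omega
    have hc : Equiv.swap s t * Equiv.swap u v = Equiv.swap u v * Equiv.swap s t := by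
      ext k
      simp only [Equiv.Perm.mul_apply, Equiv.swap_apply_def]
      split_ifs <;> simp_all
    apply toFrac_one_injective hp
    have e₁ := toFrac_braidOp (q := q) hp huv 1 f
    have e₂ := toFrac_braidOp (q := q) hp huv (Equiv.swap s t) f
    have e₃ := toFrac_braidOp (q := q) hp hst 1 (braidOp q p u v f)
    have e₁' := toFrac_braidOp (q := q) hp hst 1 f
    have e₂' := toFrac_braidOp (q := q) hp hst (Equiv.swap u v) f
    have e₃' := toFrac_braidOp (q := q) hp huv 1 (braidOp q p s t f)
    rw [hc] at e₂
    simp only [Equiv.Perm.coe_one, id_eq, one_mul, Equiv.swap_apply_of_ne_of_ne nsu nsv,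
      Equiv.swap_apply_of_ne_of_ne ntu ntv, Equiv.swap_apply_of_ne_of_ne nsu.symm ntu.symm,
      Equiv.swap_apply_of_ne_of_ne nsv.symm ntv.symm] at e₁ e₂ e₃ e₁' e₂' e₃'
    exact demazure_comm_field (fracVar_sub_ne_zero nuv) (fracVar_sub_ne_zero nst) e₁ e₂ e₃ e₁' e₂' e₃'

/-- A tensor is an eigenvector for `q` exactly if its polynomial is symmetric. -/
theorem braidOp_eq_smul_iff (hq : q ≠ 0) (hp : p ≠ 0) {s t : Fin m} (hst : (s : ℕ) + 1 = t)
    (f : (Fin m → Fin n) →₀ ℂ) :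
    braidOp q p s t f = q • f ↔
      MvPolynomial.rename (Equiv.swap s t) (toPoly p f) = toPoly p f := by
  have hne : s ≠ t := by rintro rfl; omega
  have h := toPoly_braidOp (q := q) hp hst f
  have hX : (MvPolynomial.X t - MvPolynomial.X s : MvPolynomial (Fin m) ℂ) ≠ 0 :=
    sub_ne_zero.2 fun h => hne (MvPolynomial.X_injective h).symm
  constructor
  · intro he
    rw [he, map_smul, MvPolynomial.smul_eq_C_mul] at h
    have h' : (MvPolynomial.C q * MvPolynomial.X s - MvPolynomial.C q⁻¹ * MvPolynomial.X t) *
        (MvPolynomial.rename (Equiv.swap s t) (toPoly p f) - toPoly p f) = 0 := by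
      rw [MvPolynomial.C_sub] at h
      linear_combination h
    -- The linear factor is nonzero: at x_s = 1, with all other variables 0, it takes the value q.
    refine sub_eq_zero.1 ((mul_eq_zero.1 h').resolve_left fun h0 => hq ?_)
    have := congrArg (MvPolynomial.eval (Pi.single s 1)) h0
    simpa [hne] using this
  · intro he
    apply toPoly_injective hp
    rw [he, sub_self, mul_zero, mul_zero, add_zero] at h
    rw [map_smul, MvPolynomial.smul_eq_C_mul]
    exact mul_left_cancel₀ hX (h.trans (by ring))

end BraidOpHecke

/-! ### The tensor power as a Hecke module and its intertwiners -/

section HeckeHom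

variable {m n : ℕ} {q p : ℂ}

theorem braidOp_single_of_eq (hp : p ≠ 0) {s t : Fin m} {α : Fin m → Fin n} (h : α s = α t) :
    braidOp q p s t (Finsupp.single α 1) = q • Finsupp.single α 1 := by
  have hu : Function.update (Function.update α s (α t)) t (α t) = α := by
    funext k
    simp only [Function.update_apply]
    split_ifs <;> simp_all
  rw [braidOp_single, Finset.sum_eq_single (α t), Finset.sum_eq_single (α t)]
  · rw [p_mul_R hp, R_one_eq, h, hu]
    simp
  · intro l _ hl
    rw [p_mul_R hp, R_one_eq, if_neg, mul_zero, zero_smul]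
    rw [h]
    intro h'
    exact hl (Fin.ext (by omega))
  · simp
  · intro k _ hk
    refine Finset.sum_eq_zero fun l _ => ?_
    have hk' : (k : ℕ) ≠ α t := fun h' => hk (Fin.ext h')
    rw [p_mul_R hp, R_one_eq, if_neg hk', h, sub_self]
    simp
  · simp

/-- A subspace stable under the braid operators that contains the sorted words is everything. -/
theorem single_mem_of_stable (hq : q ≠ 0) (hp : p ≠ 0) {W : Submodule ℂ ((Fin m → Fin n) →₀ ℂ)}
    (hW : ∀ s t : Fin m, (s : ℕ) + 1 = t → ∀ f ∈ W, braidOp q p s t f ∈ W)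
    (hW' : ∀ α, Monotone α → Finsupp.single α 1 ∈ W) (α : Fin m → Fin n) :
    Finsupp.single α 1 ∈ W := by
  -- Lexicographic induction: first on the sum of squares of the letters, then on `wordWeight`.
  induction hN : ∑ k, (α k : ℕ) ^ 2 using Nat.strong_induction_on generalizing α with
  | _ N IH₁ =>
  induction hw : wordWeight α using Nat.strong_induction_on generalizing α with
  | _ w IH₂ =>
  by_cases hα : Monotone α
  · exact hW' α hα
  obtain ⟨s, t, hst, hd⟩ := exists_descent hα
  have hne : s ≠ t := by rintro rfl; omega
  set β := α ∘ Equiv.swap s t with hβ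
  have hβs : β s = α t := by simp [hβ]
  have hβt : β t = α s := by simp [hβ]
  have hβN : ∑ k, (β k : ℕ) ^ 2 = N :=
    (Equiv.sum_comp (Equiv.swap s t) fun k => (α k : ℕ) ^ 2).trans hN
  have hβW : Finsupp.single β 1 ∈ W :=
    IH₂ _ (hw ▸ wordWeight_swap_lt hst hd) β hβN rfl
  have hαβ : Function.update (Function.update β s (α s)) t (α t) = α := by
    funext k
    simp only [Function.update_apply, hβ, Function.comp_apply, Equiv.swap_apply_def]
    split_ifs <;> simp_all
  have hββ : Function.update (Function.update β s (α t)) t (α s) = β := by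
    rw [← hβs, ← hβt, Function.update_eq_self, Function.update_eq_self]
  have hT := hW s t hst _ hβW
  have hd' : (α t : ℕ) < α s := hd
  rw [braidOp_single, hβs, hβt, ← Fintype.sum_prod_type' (f := fun k l =>
    (p * R n q p (α s) (α t) k l) •
      Finsupp.single (Function.update (Function.update β s k) t l) (1 : ℂ)),
    ← Finset.add_sum_erase _ _ (Finset.mem_univ (α s, α t))] at hT
  -- Applied to `β`, the operator gives `α` with coefficient q times a power of p, a multiple of
  -- `β`, and words whose two letters have the same sum but lie strictly closer together, hence have
  -- a smaller sum of squares.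
  have hrest : ∑ x ∈ Finset.univ.erase (α s, α t), (p * R n q p (α s) (α t) x.1 x.2) •
      Finsupp.single (Function.update (Function.update β s x.1) t x.2) (1 : ℂ) ∈ W := by
    refine Submodule.sum_mem _ fun x hx => ?_
    obtain ⟨k, l⟩ := x
    have hkl := (Finset.mem_erase.1 hx).1
    by_cases hsum : (k : ℕ) + l = α s + α t
    swap
    · rw [p_mul_R hp, R_one_eq, if_neg hsum, mul_zero, zero_smul]
      exact W.zero_mem
    have hks : (k : ℕ) ≠ α s := by
      intro h
      exact hkl (Prod.ext (Fin.ext h) (Fin.ext (by simp only []; omega)))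
    by_cases hk : (α t : ℕ) ≤ k ∧ (k : ℕ) < α s
    swap
    · rw [p_mul_R hp, R_one_eq, if_pos hsum, if_neg hks, if_neg hk,
        if_neg (by omega), sub_self, mul_zero, add_zero, mul_zero, zero_smul]
      exact W.zero_mem
    refine W.smul_mem _ ?_
    by_cases hkt : k = α t
    · obtain rfl : l = α s := Fin.ext (by rw [hkt] at hsum; omega)
      subst hkt
      simp only [hββ, hβW]
    · have hkt' : (k : ℕ) ≠ α t := fun h => hkt (Fin.ext h)
      refine IH₁ _ ?_ _ rfl
      have := sum_swap_eq (fun _ a => a ^ 2) β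
        (Function.update (Function.update β s k) t l) hne (fun a h1 h2 => by
          rw [Function.update_of_ne h2, Function.update_of_ne h1])
      simp only [hβN, hβs, hβt, Function.update_self, Function.update_of_ne hne] at this
      obtain ⟨d, hd₁⟩ : ∃ d, (k : ℕ) = α t + 1 + d := Nat.exists_eq_add_of_le (by omega)
      obtain ⟨e, he₁⟩ : ∃ e, (α s : ℕ) = k + 1 + e := Nat.exists_eq_add_of_le (by omega)
      have hl : (l : ℕ) = α t + 1 + e := by omega
      rw [he₁, hl, hd₁] at this
      nlinarith
  have h := (Submodule.add_mem_iff_left W hrest).1 hT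
  simp only [hαβ] at h
  refine (Submodule.smul_mem_iff W ?_).1 h
  rw [p_mul_R hp, R_one_eq, if_pos rfl, if_pos rfl, if_neg (by omega), if_neg (by omega)]
  simpa using ⟨zpow_ne_zero _ hp, hq⟩

theorem eq_top_of_stable (hq : q ≠ 0) (hp : p ≠ 0) {W : Submodule ℂ ((Fin m → Fin n) →₀ ℂ)}
    (hW : ∀ s t : Fin m, (s : ℕ) + 1 = t → ∀ f ∈ W, braidOp q p s t f ∈ W)
    (hW' : ∀ α, Monotone α → Finsupp.single α 1 ∈ W) : W = ⊤ := by
  rw [eq_top_iff]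
  intro f _
  induction f using Finsupp.induction_linear with
  | zero => exact W.zero_mem
  | add f g hf hg => exact W.add_mem (hf trivial) (hg trivial)
  | single α a =>
    rw [show Finsupp.single α a = a • Finsupp.single α (1 : ℂ) by simp]
    exact W.smul_mem _ (single_mem_of_stable hq hp hW hW' α)

/-- The vectors obtained by sorting words in the tensor power itself. -/
noncomputable def sortVec (q p : ℂ) (α : Fin m → Fin n) : (Fin m → Fin n) →₀ ℂ :=
  sortFam (braidOp q p) (fun α => Finsupp.single α 1) α

/-- The rules for ascents, ties and descents make the span stable, and it contains the sorted words.
Being n^m in number, the vectors then form a basis. -/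
theorem span_sortVec (hq : q ≠ 0) (hp : p ≠ 0) :
    Submodule.span ℂ (Set.range (sortVec q p : (Fin m → Fin n) → _)) = ⊤ := by
  have hτ := isHecke_braidOp (m := m) (n := n) hq hp
  have hf : ∀ α : Fin m → Fin n, Monotone α → ∀ s t : Fin m, (s : ℕ) + 1 = t → α s = α t →
      braidOp q p s t (Finsupp.single α 1) = q • Finsupp.single α 1 :=
    fun α _ s t _ h => braidOp_single_of_eq hp h
  have hmem : ∀ α : Fin m → Fin n, sortFam (braidOp q p) (fun α => Finsupp.single α 1) α ∈
      Submodule.span ℂ (Set.range (sortVec q p : (Fin m → Fin n) → _)) :=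
    fun α => Submodule.subset_span ⟨α, rfl⟩
  refine eq_top_of_stable hq hp (fun s t hst f hfW => ?_) fun α hα => ?_
  · induction hfW using Submodule.span_induction with
    | mem f h =>
      obtain ⟨α, rfl⟩ := h
      rw [sortVec]
      rcases lt_trichotomy (α s) (α t) with h | h | h
      · rw [sortFam_ascent hτ hf hst h]
        exact hmem _
      · rw [(sortFam_spec hτ hf α).2 s t hst h]
        exact Submodule.smul_mem _ _ (hmem _)
      · rw [sortFam_descent hτ hf hst h]
        exact Submodule.add_mem _ (hmem _) (Submodule.smul_mem _ _ (hmem _))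
    | zero => rw [map_zero]; exact Submodule.zero_mem _
    | add f g _ _ hf hg => rw [map_add]; exact Submodule.add_mem _ hf hg
    | smul c f _ hf => rw [map_smul]; exact Submodule.smul_mem _ _ hf
  · rw [← sortFam_of_monotone (braidOp q p) (fun α => Finsupp.single α (1 : ℂ)) hα]
    exact hmem α

/-- The basis of vectors obtained by sorting words. -/
noncomputable def sortBasis (hq : q ≠ 0) (hp : p ≠ 0) :
    Module.Basis (Fin m → Fin n) ℂ ((Fin m → Fin n) →₀ ℂ) :=
  basisOfTopLeSpanOfCardEqFinrank (sortVec q p) (span_sortVec hq hp).ge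
    (Module.finrank_finsupp_self ℂ).symm

theorem sortBasis_apply (hq : q ≠ 0) (hp : p ≠ 0) (α : Fin m → Fin n) :
    sortBasis hq hp α = sortFam (braidOp q p) (fun α => Finsupp.single α 1) α := by
  rw [sortBasis, coe_basisOfTopLeSpanOfCardEqFinrank, sortVec]

variable {M : Type} [AddCommGroup M] [Module ℂ M]

/-- Linear maps from the tensor power that intertwine the braid operators with `τ`. -/
def heckeHom (n : ℕ) (q p : ℂ) (τ : Fin m → Fin m → M →ₗ[ℂ] M) :
    Submodule ℂ (((Fin m → Fin n) →₀ ℂ) →ₗ[ℂ] M) where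
  carrier := {Φ | ∀ s t : Fin m, (s : ℕ) + 1 = t → ∀ f, Φ (braidOp q p s t f) = τ s t (Φ f)}
  add_mem' := fun {Φ Ψ} hΦ hΨ s t h f => by
    rw [LinearMap.add_apply, LinearMap.add_apply, hΦ s t h, hΨ s t h, map_add]
  zero_mem' := fun s t h f => by simp
  smul_mem' := fun c Φ hΦ s t h f => by
    rw [LinearMap.smul_apply, LinearMap.smul_apply, hΦ s t h, map_smul]

/-- Vectors on which `τ` acts by `q` wherever the word `α` repeats a letter. -/
def tieInv {n : ℕ} (q : ℂ) (τ : Fin m → Fin m → M →ₗ[ℂ] M) (α : Fin m → Fin n) :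
    Submodule ℂ M where
  carrier := {x | ∀ s t : Fin m, (s : ℕ) + 1 = t → α s = α t → τ s t x = q • x}
  add_mem' := fun {x y} hx hy s t h h' => by
    rw [map_add, hx s t h h', hy s t h h', smul_add]
  zero_mem' := fun s t h h' => by rw [map_zero, smul_zero]
  smul_mem' := fun c x hx s t h h' => by rw [map_smul, hx s t h h', smul_comm]

/-- Evaluation of intertwiners at sorted words. -/
noncomputable def evalMono (hp : p ≠ 0) (τ : Fin m → Fin m → M →ₗ[ℂ] M) :
    heckeHom n q p τ →ₗ[ℂ] Π α : {α : Fin m → Fin n // Monotone α}, tieInv q τ α.1 where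
  toFun Φ α := ⟨Φ.1 (Finsupp.single α.1 1), fun s t h h' => by
    rw [← Φ.2 s t h, braidOp_single_of_eq hp h', map_smul]⟩
  map_add' _ _ := rfl
  map_smul' _ _ := rfl

/-- Frobenius reciprocity. An intertwiner vanishing on sorted words has a stable kernel, hence is
zero. For existence, the sorting basis is sent to the sorting family in `M`; both families obey the
same rules, so the map intertwines. -/
theorem evalMono_bijective (hq : q ≠ 0) (hp : p ≠ 0) {τ : Fin m → Fin m → M →ₗ[ℂ] M}
    (hτ : IsHecke q τ) : Function.Bijective (evalMono (n := n) (q := q) hp τ) := by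
  classical
  constructor
  · rw [← LinearMap.ker_eq_bot, LinearMap.ker_eq_bot']
    intro Φ hΦ
    have : LinearMap.ker Φ.1 = ⊤ := by
      refine eq_top_of_stable hq hp (fun s t hst f hf => ?_) fun α hα => ?_
      · rw [LinearMap.mem_ker] at hf ⊢
        rw [Φ.2 s t hst, hf, map_zero]
      · exact congrArg Subtype.val (congrFun hΦ ⟨α, hα⟩)
    exact Subtype.ext (LinearMap.ker_eq_top.1 this)
  · intro x
    set f : (Fin m → Fin n) → M := fun α => if h : Monotone α then (x ⟨α, h⟩).1 else 0 with hf_def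
    have hfx : ∀ α (h : Monotone α), f α = (x ⟨α, h⟩).1 := fun α h => dif_pos h
    have hf : ∀ α, Monotone α → ∀ s t : Fin m, (s : ℕ) + 1 = t → α s = α t →
        τ s t (f α) = q • f α := by
      intro α hα s t hst h
      rw [hfx α hα]
      exact (x ⟨α, hα⟩).2 s t hst h
    have hB := isHecke_braidOp (m := m) (n := n) hq hp
    have hfB : ∀ α : Fin m → Fin n, Monotone α → ∀ s t : Fin m, (s : ℕ) + 1 = t → α s = α t →
        braidOp q p s t (Finsupp.single α 1) = q • Finsupp.single α 1 :=
      fun α _ s t _ h => braidOp_single_of_eq hp h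
    set Φ := (sortBasis hq hp).constr ℂ (sortFam τ f) with hΦ
    have hΦb : ∀ α, Φ (sortFam (braidOp q p) (fun α => Finsupp.single α 1) α) = sortFam τ f α := by
      intro α
      rw [← sortBasis_apply hq hp, hΦ, Module.Basis.constr_basis]
    refine ⟨⟨Φ, fun s t hst g => ?_⟩, ?_⟩
    · suffices h : Φ ∘ₗ braidOp q p s t = τ s t ∘ₗ Φ from LinearMap.congr_fun h g
      refine (sortBasis hq hp).ext fun α => ?_
      rw [LinearMap.comp_apply, LinearMap.comp_apply, sortBasis_apply, hΦb]
      rcases lt_trichotomy (α s) (α t) with h | h | h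
      · rw [sortFam_ascent hB hfB hst h, sortFam_ascent hτ hf hst h, hΦb]
      · rw [(sortFam_spec hB hfB α).2 s t hst h, (sortFam_spec hτ hf α).2 s t hst h, map_smul, hΦb]
      · rw [sortFam_descent hB hfB hst h, sortFam_descent hτ hf hst h, map_add, map_smul, hΦb, hΦb]
    · funext α
      refine Subtype.ext ?_
      change Φ (Finsupp.single α.1 1) = _
      have := hΦb α.1
      rwa [sortFam_of_monotone _ _ α.2, sortFam_of_monotone _ _ α.2, hfx α.1 α.2] at this

theorem finrank_heckeHom (hq : q ≠ 0) (hp : p ≠ 0) {τ : Fin m → Fin m → M →ₗ[ℂ] M}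
    (hτ : IsHecke q τ) : Module.finrank ℂ (heckeHom n q p τ) =
      Module.finrank ℂ (Π α : {α : Fin m → Fin n // Monotone α}, tieInv q τ α.1) :=
  (LinearEquiv.ofBijective _ (evalMono_bijective hq hp hτ)).finrank_eq

end HeckeHom

/-! ### Counting sorted words and their generating series -/

section Counting

theorem card_monotone (m : ℕ) (L : Type) [LinearOrder L] [Fintype L] :
    Nat.card {γ : Fin m → L // Monotone γ} = (Fintype.card L).multichoose m := by
  classical
  rw [← Sym.card_sym_eq_multichoose, ← Nat.card_eq_fintype_card]
  refine Nat.card_eq_of_bijective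
    (fun γ => ⟨(List.ofFn γ.1 : Multiset L), by simp⟩) ⟨fun γ δ h => ?_, fun z => ?_⟩
  · have h' := Multiset.coe_eq_coe.1 (congrArg Subtype.val h)
    exact Subtype.ext (List.ofFn_injective
      (h'.eq_of_sortedLE γ.2.sortedLE_ofFn δ.2.sortedLE_ofFn))
  · obtain ⟨z, hz⟩ := z
    induction z using Quotient.inductionOn with
    | _ l =>
    have hl : l.length = m := hz
    subst hl
    refine ⟨⟨l.get ∘ Tuple.sort l.get, Tuple.monotone_sort _⟩, Subtype.ext ?_⟩
    refine Multiset.coe_eq_coe.2 (((Tuple.sort l.get).ofFn_comp_perm l.get).trans ?_)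
    rw [List.ofFn_get]

theorem card_strictMono (m n : ℕ) :
    Nat.card {γ : Fin m → Fin n // StrictMono γ} = n.choose m := by
  have := Fintype.card_finset_len (α := Fin n) m
  rw [Fintype.card_fin, ← Nat.card_eq_fintype_card] at this
  rw [← this]
  refine Nat.card_eq_of_bijective
    (fun γ => ⟨Finset.univ.map ⟨γ.1, γ.2.injective⟩, by simp⟩) ⟨fun γ δ h => ?_, fun z => ?_⟩
  · have h' := congrArg (fun z : Finset (Fin n) => (z : Set (Fin n))) (congrArg Subtype.val h)
    simp only [Finset.coe_map, Finset.coe_univ, Set.image_univ] at h'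
    exact Subtype.ext ((γ.2.range_inj δ.2).1 h')
  · refine ⟨⟨z.1.orderEmbOfFin z.2, (z.1.orderEmbOfFin z.2).strictMono⟩, Subtype.ext ?_⟩
    apply Finset.coe_injective
    simp

theorem mk_multichoose (n : ℕ) :
    (PowerSeries.mk fun m => (n.multichoose m : ℚ)) = ((1 - PowerSeries.X) ^ n)⁻¹ := by
  rw [PowerSeries.eq_inv_iff_mul_eq_one (by simp)]
  cases n with
  | zero =>
    rw [pow_zero, mul_one]
    ext m
    cases m <;> simp [PowerSeries.coeff_one]
  | succ d =>
    convert PowerSeries.mk_add_choose_mul_one_sub_pow_eq_one ℚ d using 4 with m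
    rw [Nat.multichoose_eq, show d + 1 + m - 1 = d + m by omega, Nat.choose_symm_add]

theorem mk_choose (n : ℕ) :
    (PowerSeries.mk fun m => (n.choose m : ℚ)) = (1 + PowerSeries.X) ^ n := by
  have h : ((1 + PowerSeries.X) ^ n : PowerSeries ℚ) =
      ((1 + Polynomial.X : Polynomial ℚ) ^ n : Polynomial ℚ) := by simp
  rw [h]
  ext m
  rw [PowerSeries.coeff_mk, Polynomial.coeff_coe, Polynomial.coeff_one_add_X_pow]

end Counting

/-! ### One-dimensional Hecke modules -/

section ScalarReps

variable {m n : ℕ} {q : ℂ}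

/-- The admissible scalars are q and -q⁻¹, used for S(R) and Λ(R) respectively. -/
theorem isHecke_smul {ε : ℂ} (hε : ε * ε = 1 + (q - q⁻¹) * ε) :
    IsHecke q (fun _ _ : Fin m => (ε • LinearMap.id : ℂ →ₗ[ℂ] ℂ)) where
  quad s t _ x := by
    simp only [LinearMap.smul_apply, LinearMap.id_apply, smul_eq_mul]
    linear_combination x * hε
  braid _ _ _ _ _ _ := rfl
  comm _ _ _ _ _ _ _ _ := rfl

theorem finrank_pi_tieInv_self :
    Module.finrank ℂ (Π α : {α : Fin m → Fin n // Monotone α},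
      tieInv q (fun _ _ => (q • LinearMap.id : ℂ →ₗ[ℂ] ℂ)) α.1) = n.multichoose m := by
  classical
  have h : ∀ α : Fin m → Fin n, tieInv q (fun _ _ => (q • LinearMap.id : ℂ →ₗ[ℂ] ℂ)) α = ⊤ :=
    fun α => eq_top_iff.2 fun x _ s t _ _ => rfl
  rw [Module.finrank_pi_fintype, Finset.sum_congr rfl (fun α _ => by
    rw [h, finrank_top, Module.finrank_self])]
  have := card_monotone m (Fin n)
  rw [Fintype.card_fin, Nat.card_eq_fintype_card] at this
  simp [this]

/-- A tie forces -q⁻¹x = qx, so x = 0 as q² ≠ -1. A sorted word without adjacent ties is strictly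
increasing and imposes no condition. -/
theorem finrank_pi_tieInv_neg_inv (hq : q ≠ 0) (hq2 : q ^ 2 ≠ -1) :
    Module.finrank ℂ (Π α : {α : Fin m → Fin n // Monotone α},
      tieInv q (fun _ _ => ((-q⁻¹) • LinearMap.id : ℂ →ₗ[ℂ] ℂ)) α.1) = n.choose m := by
  classical
  have h : ∀ α : {α : Fin m → Fin n // Monotone α},
      Module.finrank ℂ (tieInv q (fun _ _ => ((-q⁻¹) • LinearMap.id : ℂ →ₗ[ℂ] ℂ)) α.1) =
        if StrictMono α.1 then 1 else 0 := by
    rintro ⟨α, hα⟩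
    split_ifs with hs
    · have : tieInv q (fun _ _ => ((-q⁻¹) • LinearMap.id : ℂ →ₗ[ℂ] ℂ)) α = ⊤ :=
        eq_top_iff.2 fun x _ s t hst h => by
          obtain rfl := hs.injective h
          omega
      rw [this, finrank_top, Module.finrank_self]
    · have : tieInv q (fun _ _ => ((-q⁻¹) • LinearMap.id : ℂ →ₗ[ℂ] ℂ)) α = ⊥ := by
        rw [eq_bot_iff]
        intro x hx
        have hex : ∃ s t : Fin m, (s : ℕ) + 1 = t ∧ α s = α t := by
          cases m with
          | zero => exact absurd (fun a => a.elim0) hs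
          | succ m =>
            rw [Fin.strictMono_iff_lt_succ] at hs
            push Not at hs
            obtain ⟨i, hi⟩ := hs
            exact ⟨i.castSucc, i.succ, by simp, le_antisymm (hα (Fin.castSucc_le_succ i)) hi⟩
        obtain ⟨s, t, hst, h⟩ := hex
        have := hx s t hst h
        simp only [LinearMap.smul_apply, LinearMap.id_apply, smul_eq_mul] at this
        have h2 : (q ^ 2 + 1) * x = 0 := by
          field_simp at this
          linear_combination -this
        rcases mul_eq_zero.1 h2 with h3 | h3
        · exact absurd (eq_neg_of_add_eq_zero_left h3) hq2
        · exact h3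
      rw [this, finrank_bot]
  rw [Module.finrank_pi_fintype, Finset.sum_congr rfl (fun α _ => h α), Finset.sum_boole,
    ← card_strictMono, Nat.card_eq_fintype_card, ← Fintype.card_subtype]
  exact Fintype.card_congr
    ⟨fun α => ⟨α.1.1, α.2⟩, fun α => ⟨⟨α.1, α.2.monotone⟩, α.2⟩, fun _ => rfl, fun _ => rfl⟩

end ScalarReps

/-! ### Tie-invariant vectors in the tensor power -/

section BraidTies

variable {m n : ℕ} {q p : ℂ}

/-- The coefficient of the monomial of a word. -/
noncomputable def wordScale (p : ℂ) (α : Fin m → Fin n) : ℂ :=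
  ∏ k : Fin m, (p ^ (-2 * (k : ℤ))) ^ (α k : ℕ)

theorem wordScale_ne_zero (hp : p ≠ 0) (α : Fin m → Fin n) : wordScale p α ≠ 0 :=
  Finset.prod_ne_zero_iff.2 fun _ _ => pow_ne_zero _ (zpow_ne_zero _ hp)

theorem toPoly_apply (p : ℂ) (f : (Fin m → Fin n) →₀ ℂ) :
    toPoly p f = ∑ α, f α • wordMonomial p α := by
  rw [toPoly, Finsupp.linearCombination_apply]
  exact Finsupp.sum_fintype _ _ (fun _ => zero_smul _ _)

theorem toPoly_eq (p : ℂ) (f : (Fin m → Fin n) →₀ ℂ) :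
    toPoly p f = toPoly 1 (Finsupp.equivFunOnFinite.symm fun α => wordScale p α * f α) := by
  have h : ∀ α : Fin m → Fin n, wordMonomial p α = wordScale p α • wordMonomial 1 α := by
    intro α
    rw [wordMonomial, wordMonomial, wordScale, MvPolynomial.smul_eq_C_mul]
    simp only [one_zpow, MvPolynomial.C_1, one_mul, mul_pow, Finset.prod_mul_distrib, map_prod,
      MvPolynomial.C_pow]
  rw [toPoly_apply, toPoly_apply]
  refine Finset.sum_congr rfl fun α _ => ?_
  rw [h, smul_smul, mul_comm]
  rfl

theorem rename_toPoly_one (e : Equiv.Perm (Fin m)) (f : (Fin m → Fin n) →₀ ℂ) :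
    MvPolynomial.rename e (toPoly 1 f) =
      toPoly 1 (Finsupp.equivFunOnFinite.symm fun α => f (α ∘ e)) := by
  have h : ∀ α : Fin m → Fin n,
      MvPolynomial.rename e (wordMonomial 1 (α ∘ e)) = wordMonomial 1 α := by
    intro α
    simp only [wordMonomial, one_zpow, MvPolynomial.C_1, one_mul, map_prod, map_pow,
      MvPolynomial.rename_X, Function.comp_apply]
    exact Equiv.prod_comp e fun k => (MvPolynomial.X k : MvPolynomial (Fin m) ℂ) ^ (α k : ℕ)
  rw [toPoly_apply, toPoly_apply, map_sum]
  simp only [map_smul]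
  rw [← Equiv.sum_comp (Equiv.arrowCongr e.symm (Equiv.refl (Fin n)))]
  refine Finset.sum_congr rfl fun α _ => ?_
  exact congrArg (f (α ∘ e) • ·) (h α)

theorem braidOp_eq_smul_iff_coeff (hq : q ≠ 0) (hp : p ≠ 0) {s t : Fin m}
    (hst : (s : ℕ) + 1 = t) (f : (Fin m → Fin n) →₀ ℂ) :
    braidOp q p s t f = q • f ↔ ∀ β, wordScale p (β ∘ Equiv.swap s t) * f (β ∘ Equiv.swap s t) =
      wordScale p β * f β := by
  rw [braidOp_eq_smul_iff hq hp hst, toPoly_eq, rename_toPoly_one,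
    (toPoly_injective one_ne_zero).eq_iff, Finsupp.equivFunOnFinite.symm.injective.eq_iff,
    funext_iff]
  rfl

/-- The pair of words with letters in lexicographically ordered pairs. -/
def zipLex (α β : Fin m → Fin n) : Fin m → Fin n ×ₗ Fin n := fun k => toLex (α k, β k)

/-- Evaluation at lexicographically sorted pairs of words. -/
noncomputable def evalLex (n : ℕ) (q p : ℂ) :
    (Π α : {α : Fin m → Fin n // Monotone α},
      tieInv q (braidOp (n := n) q p) α.1) →ₗ[ℂ]
    ({γ : Fin m → Fin n ×ₗ Fin n // Monotone γ} → ℂ) where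
  toFun x γ := wordScale p (fun k => (ofLex (γ.1 k)).2) *
    (x ⟨fun k => (ofLex (γ.1 k)).1, fun _ _ h => Prod.Lex.monotone_fst _ _ (γ.2 h)⟩).1
      (fun k => (ofLex (γ.1 k)).2)
  map_add' x y := funext fun γ => by simp [mul_add]
  map_smul' c x := funext fun γ => by simp [mul_left_comm]

/-- For fixed `α`, the rescaled coefficients are constant on orbits of `β` under swaps at ties of
`α`. Each orbit has exactly one `β` that increases along the ties, which says that the word of pairs
is lexicographically sorted. -/
theorem evalLex_bijective (hq : q ≠ 0) (hp : p ≠ 0) :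
    Function.Bijective (evalLex (m := m) n q p) := by
  constructor
  · rw [← LinearMap.ker_eq_bot, LinearMap.ker_eq_bot']
    intro x hx
    funext ⟨α, hα⟩
    refine Subtype.ext (Finsupp.ext fun β => ?_)
    change (x ⟨α, hα⟩).1 β = 0
    induction hN : wordWeight β using Nat.strong_induction_on generalizing β with
    | _ N IH =>
    by_cases hγ : Monotone (zipLex α β)
    · have := congrFun hx ⟨zipLex α β, hγ⟩
      exact (mul_eq_zero.1 this).resolve_left (wordScale_ne_zero hp _)
    · obtain ⟨s, t, hst, hd⟩ := exists_descent hγ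
      have hle : α s ≤ α t := hα (Fin.le_def.2 (by omega))
      rw [zipLex, zipLex, Prod.Lex.toLex_lt_toLex] at hd
      have hd' : α s = α t ∧ β t < β s := by
        rcases hd with h | h
        · exact absurd h (not_lt.2 hle)
        · exact ⟨h.1.symm, h.2⟩
      have h0 := IH _ (hN ▸ wordWeight_swap_lt hst hd'.2) (β ∘ Equiv.swap s t) rfl
      have h1 := (braidOp_eq_smul_iff_coeff hq hp hst _).1 ((x ⟨α, hα⟩).2 s t hst hd'.1) β
      rw [h0, mul_zero] at h1
      exact (mul_eq_zero.1 h1.symm).resolve_left (wordScale_ne_zero hp _)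
  · intro c
    -- Sorting the word of pairs makes the rescaled coefficient depend on the orbit only.
    refine ⟨fun α => ⟨Finsupp.equivFunOnFinite.symm fun β => (wordScale p β)⁻¹ *
      c ⟨zipLex α.1 β ∘ Tuple.sort (zipLex α.1 β), Tuple.monotone_sort _⟩,
      fun s t hst h => ?_⟩, ?_⟩
    · rw [braidOp_eq_smul_iff_coeff hq hp hst]
      intro β
      have hz : zipLex α.1 (β ∘ Equiv.swap s t) = zipLex α.1 β ∘ Equiv.swap s t := by
        funext k
        have : α.1 k = α.1 (Equiv.swap s t k) := by
          rw [Equiv.swap_apply_def]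
          split_ifs with h1 h2
          · rw [h1, h]
          · rw [h2, h]
          · rfl
        simp only [zipLex, Function.comp_apply, ← this]
      simp only [Finsupp.equivFunOnFinite_symm_apply_apply]
      rw [mul_inv_cancel_left₀ (wordScale_ne_zero hp _),
        mul_inv_cancel_left₀ (wordScale_ne_zero hp _)]
      congr 2
      rw [hz, Tuple.comp_perm_comp_sort_eq_comp_sort]
    · funext γ
      have h1 := wordScale_ne_zero hp (fun k => (ofLex (γ.1 k)).2)
      refine (mul_inv_cancel_left₀ h1 _).trans ?_
      congr 1
      refine Subtype.ext ?_
      change γ.1 ∘ Tuple.sort γ.1 = γ.1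
      rw [Tuple.sort_eq_refl_iff_monotone.2 γ.2]
      rfl

theorem finrank_pi_tieInv_braidOp (hq : q ≠ 0) (hp : p ≠ 0) :
    Module.finrank ℂ (Π α : {α : Fin m → Fin n // Monotone α},
      tieInv q (braidOp (n := n) q p) α.1) = (n ^ 2).multichoose m := by
  classical
  rw [(LinearEquiv.ofBijective _ (evalLex_bijective hq hp)).finrank_eq,
    Module.finrank_fintype_fun_eq_card, ← Nat.card_eq_fintype_card, card_monotone]
  congr 1
  exact (Fintype.card_congr ofLex).trans (by rw [Fintype.card_prod, Fintype.card_fin, sq])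

end BraidTies

/-! ### Solutions of the relations as Hecke intertwiners -/

section Solutions

variable {m n : ℕ} {q p : ℂ} {M : Type} [AddCommGroup M] [Module ℂ M]

theorem mem_heckeHom_iff {τ : Fin m → Fin m → M →ₗ[ℂ] M} {Φ : ((Fin m → Fin n) →₀ ℂ) →ₗ[ℂ] M} :
    Φ ∈ heckeHom n q p τ ↔ ∀ s t : Fin m, (s : ℕ) + 1 = t → ∀ α,
      Φ (braidOp q p s t (Finsupp.single α 1)) = τ s t (Φ (Finsupp.single α 1)) := by
  refine ⟨fun h s t hst α => h s t hst _, fun h s t hst f => ?_⟩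
  suffices h' : Φ ∘ₗ braidOp q p s t = τ s t ∘ₗ Φ from LinearMap.congr_fun h' f
  refine Finsupp.lhom_ext' fun α => LinearMap.ext_ring ?_
  exact h s t hst α

/-- Coefficients of the relations `δ (ε x_j x_i - p ∑ R_{ij}^{kl} x_k x_l)`. -/
noncomputable def eigenCoeff (n : ℕ) (q p δ ε : ℂ) (ij : Fin n × Fin n) (x y : Fin n) : ℂ :=
  δ * ((if x = ij.2 ∧ y = ij.1 then ε else 0) - p * R n q p ij.1 ij.2 x y)

theorem sum_eigenCoeff (δ ε : ℂ) (i j : Fin n) (φ : Fin n → Fin n → M) :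
    ∑ x, ∑ y, eigenCoeff n q p δ ε (i, j) x y • φ x y =
      δ • (ε • φ j i - ∑ x, ∑ y, (p * R n q p i j x y) • φ x y) := by
  simp only [eigenCoeff, mul_smul, ← Finset.smul_sum, sub_smul, Finset.sum_sub_distrib]
  congr 2
  rw [Finset.sum_eq_single j, Finset.sum_eq_single i]
  · simp
  · intro y _ hy
    rw [if_neg (fun h => hy h.2), zero_smul]
  · simp
  · intro x _ hx
    refine Finset.sum_eq_zero fun y _ => ?_
    rw [if_neg (fun h => hx h.1), zero_smul]
  · simp

theorem update_update_update_update {X : Type} (w : Fin m → X) (s t : Fin m)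
    (a b x y : X) :
    Function.update (Function.update (Function.update (Function.update w s a) t b) s x) t y =
      Function.update (Function.update w s x) t y := by
  funext k
  simp only [Function.update_apply]
  split_ifs <;> rfl

/-- The relation for (i, j) inserted at s, t is the intertwining condition tested on the word with j
at s and i at t. The factor `δ` only adjusts the sign. -/
theorem finrank_quadSol_eigenCoeff {δ : ℂ} (hδ : δ ≠ 0) (ε : ℂ) :
    Module.finrank ℂ (quadSol (eigenCoeff n q p δ ε) m) =
      Module.finrank ℂ (heckeHom (m := m) n q p
        (fun _ _ => (ε • LinearMap.id : ℂ →ₗ[ℂ] ℂ))) := by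
  have h : quadSol (eigenCoeff n q p δ ε) m =
      (heckeHom (m := m) n q p (fun _ _ => (ε • LinearMap.id : ℂ →ₗ[ℂ] ℂ))).comap
        (Finsupp.llift ℂ ℂ ℂ (Fin m → Fin n)).toLinearMap := by
    ext φ
    have hs : ∀ α, Finsupp.llift ℂ ℂ ℂ (Fin m → Fin n) φ (Finsupp.single α 1) = φ α := by
      intro α
      simp
    have hb : ∀ s t α, Finsupp.llift ℂ ℂ ℂ (Fin m → Fin n) φ
        (braidOp q p s t (Finsupp.single α 1)) = ∑ x, ∑ y, (p * R n q p (α t) (α s) x y) •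
          φ (Function.update (Function.update α s x) t y) := by
      intro s t α
      rw [braidOp_single, map_sum]
      simp only [map_sum, map_smul, hs]
    rw [Submodule.mem_comap, LinearEquiv.coe_coe, mem_heckeHom_iff]
    constructor
    · intro hφ s t hst α
      have := hφ (α t, α s) s t hst α
      simp only [← smul_eq_mul] at this
      rw [sum_eigenCoeff _ _ _ _ (fun x y => φ (Function.update (Function.update α s x) t y)),
        smul_eq_zero_iff_right hδ, sub_eq_zero, Function.update_eq_self,
        Function.update_eq_self] at this
      rw [hb, hs, ← this]
      rfl
    · rintro hφ ⟨i, j⟩ s t hst w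
      have hne : s ≠ t := by rintro rfl; omega
      simp only [← smul_eq_mul]
      rw [sum_eigenCoeff _ _ _ _ (fun x y => φ (Function.update (Function.update w s x) t y)),
        smul_eq_zero_iff_right hδ, sub_eq_zero]
      have := hφ s t hst (Function.update (Function.update w s j) t i)
      rw [hb, hs] at this
      simp only [Function.update_self, Function.update_of_ne hne,
        update_update_update_update] at this
      exact this.symm
  rw [h]
  exact ((Finsupp.llift ℂ ℂ ℂ (Fin m → Fin n)).ofSubmodule' _).finrank_eq

/-- The definition gives the columns of the operator; this gives its rows, which is the form in
which R enters the right-hand side of the A(R) relations. -/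
theorem braidOp_apply {s t : Fin m} (hne : s ≠ t) (f : (Fin m → Fin n) →₀ ℂ) (β : Fin m → Fin n) :
    braidOp q p s t f β = ∑ x, ∑ y, (p * R n q p y x (β s) (β t)) *
      f (Function.update (Function.update β s x) t y) := by
  induction f using Finsupp.induction_linear with
  | zero => simp
  | add f g hf hg =>
    rw [map_add, Finsupp.add_apply, hf, hg]
    simp only [Finsupp.add_apply, mul_add, Finset.sum_add_distrib]
  | single α a =>
    rw [show Finsupp.single α a = a • Finsupp.single α (1 : ℂ) by simp, map_smul, braidOp_single]
    simp only [Finsupp.smul_apply, Finsupp.finsetSum_apply, Finsupp.single_apply, smul_eq_mul,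
      mul_left_comm _ a, ← Finset.mul_sum]
    congr 1
    have key : ∀ α β : Fin m → Fin n, ∀ x y,
        Function.update (Function.update α s x) t y = β ↔
          Function.update (Function.update α s (β s)) t (β t) = β ∧ x = β s ∧ y = β t := by
      intro α β x y
      constructor
      · rintro rfl
        simp [Function.update_of_ne hne]
      · rintro ⟨h, rfl, rfl⟩
        exact h
    have symm : Function.update (Function.update α s (β s)) t (β t) = β ↔
        Function.update (Function.update β s (α s)) t (α t) = α := by
      simp only [funext_iff, Function.update_apply]
      refine forall_congr' fun k => ?_
      split_ifs with h1 h2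
      · simp [h1]
      · simp [h2]
      · exact eq_comm
    have key₁ := key α β
    have key₂ : ∀ x y, α = Function.update (Function.update β s x) t y ↔
        Function.update (Function.update α s (β s)) t (β t) = β ∧ x = α s ∧ y = α t :=
      fun x y => eq_comm.trans ((key β α x y).trans (and_congr_left' symm.symm))
    clear key symm
    generalize (Function.update (Function.update α s (β s)) t (β t) = β) = P at key₁ key₂
    classical
    trans ∑ x, ∑ y, p * R n q p (α t) (α s) x y * (if P ∧ x = β s ∧ y = β t then 1 else 0)
    · exact Finset.sum_congr rfl fun x _ => Finset.sum_congr rfl fun y _ =>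
        congrArg _ (if_congr (key₁ x y) rfl rfl)
    trans ∑ x, ∑ y, p * R n q p y x (β s) (β t) * (if P ∧ x = α s ∧ y = α t then 1 else 0)
    · by_cases h : P
      · simp [h, ite_and]
      · simp [h]
    · exact Finset.sum_congr rfl fun x _ => Finset.sum_congr rfl fun y _ =>
        congrArg _ (if_congr (key₂ x y).symm rfl rfl)

/-- Coefficients of the relations of `A(R)`. -/
noncomputable def frtCoeff (n : ℕ) (q p : ℂ) (w : Fin n × Fin n × Fin n × Fin n)
    (x y : Fin n × Fin n) : ℂ :=
  (if x.2 = w.2.2.1 ∧ y.2 = w.2.2.2 then R n q p w.2.1 w.1 x.1 y.1 else 0) -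
    (if x.1 = w.1 ∧ y.1 = w.2.1 then R n q p y.2 x.2 w.2.2.1 w.2.2.2 else 0)

theorem sum_frtCoeff (i j k l : Fin n) (φ : Fin n × Fin n → Fin n × Fin n → M) :
    ∑ x, ∑ y, frtCoeff n q p (i, j, k, l) x y • φ x y =
      ∑ u, ∑ v, R n q p j i u v • φ (u, k) (v, l) -
        ∑ u, ∑ v, R n q p v u k l • φ (i, u) (j, v) := by
  simp only [frtCoeff, sub_smul, Finset.sum_sub_distrib]
  congr 1
  · simp only [Fintype.sum_prod_type, ite_smul, zero_smul, ite_and, Finset.sum_ite_irrel,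
      Finset.sum_const_zero, Finset.sum_ite_eq', Finset.mem_univ, if_true]
  · simp only [Fintype.sum_prod_type, ite_smul, zero_smul, ite_and, Finset.sum_ite_irrel,
      Finset.sum_const_zero, Finset.sum_ite_eq', Finset.mem_univ, if_true]

/-- Functions on words in pairs as matrices indexed by words. -/
noncomputable def pairEquiv (m n : ℕ) : ((Fin m → Fin n × Fin n) → ℂ) ≃ₗ[ℂ]
    (((Fin m → Fin n) →₀ ℂ) →ₗ[ℂ] ((Fin m → Fin n) →₀ ℂ)) :=
  LinearEquiv.funCongrLeft ℂ ℂ (Equiv.arrowProdEquivProdArrow (Fin m) (fun _ => Fin n)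
      (fun _ => Fin n)).symm ≪≫ₗ LinearEquiv.curry ℂ ℂ _ _ ≪≫ₗ
    LinearEquiv.piCongrRight (fun _ => (Finsupp.linearEquivFunOnFinite ℂ ℂ _).symm) ≪≫ₗ
    Finsupp.llift _ ℂ ℂ _

theorem pairEquiv_single (φ : (Fin m → Fin n × Fin n) → ℂ) (α β : Fin m → Fin n) :
    pairEquiv m n φ (Finsupp.single α 1) β = φ (fun k => (α k, β k)) := by
  simp [pairEquiv]
  rfl

theorem pair_update {α β : Fin m → Fin n} (s : Fin m) (x : Fin n) (y : Fin n) :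
    (fun k => (Function.update α s x k, Function.update β s y k)) =
      Function.update (fun k => (α k, β k)) s (x, y) := by
  funext k
  simp only [Function.update_apply]
  split_ifs <;> rfl

/-- Read as a matrix indexed by pairs of words, a solution satisfies the A(R) relations at s, t
exactly when it commutes with the braid operator there, entry by entry. -/
theorem finrank_quadSol_frtCoeff (hp : p ≠ 0) :
    Module.finrank ℂ (quadSol (frtCoeff n q p) m) =
      Module.finrank ℂ (heckeHom (m := m) n q p (braidOp (n := n) q p)) := by
  have h : quadSol (frtCoeff n q p) m =
      (heckeHom (m := m) n q p (braidOp (n := n) q p)).comap (pairEquiv m n).toLinearMap := by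
    ext φ
    have hb : ∀ s t : Fin m, s ≠ t → ∀ α β,
        pairEquiv m n φ (braidOp q p s t (Finsupp.single α 1)) β =
          p • ∑ x, ∑ y, R n q p (α t) (α s) x y •
            φ (Function.update (Function.update (fun k => (α k, β k)) s (x, β s)) t (y, β t)) := by
      intro s t hne α β
      rw [braidOp_single, map_sum]
      simp only [map_sum, map_smul, Finsupp.finsetSum_apply, Finsupp.smul_apply, pairEquiv_single,
        Finset.smul_sum, mul_smul]
      refine Finset.sum_congr rfl fun x _ => Finset.sum_congr rfl fun y _ => ?_
      congr 3
      rw [← pair_update, ← pair_update, Function.update_eq_self, Function.update_eq_self]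
    have hb' : ∀ s t : Fin m, s ≠ t → ∀ α β,
        braidOp q p s t (pairEquiv m n φ (Finsupp.single α 1)) β =
          p • ∑ x, ∑ y, R n q p y x (β s) (β t) •
            φ (Function.update (Function.update (fun k => (α k, β k)) s (α s, x)) t (α t, y)) := by
      intro s t hne α β
      rw [braidOp_apply hne]
      simp only [pairEquiv_single, Finset.mul_sum, smul_eq_mul, mul_assoc]
      refine Finset.sum_congr rfl fun x _ => Finset.sum_congr rfl fun y _ => ?_
      congr 3
      rw [← pair_update, ← pair_update, Function.update_eq_self, Function.update_eq_self]
    rw [Submodule.mem_comap, LinearEquiv.coe_coe, mem_heckeHom_iff]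
    constructor
    · intro hφ s t hst α
      have hne : s ≠ t := by rintro rfl; omega
      ext β
      have := hφ (α s, α t, β s, β t) s t hst (fun k => (α k, β k))
      simp only [← smul_eq_mul] at this
      rw [sum_frtCoeff _ _ _ _ (fun x y => φ (Function.update (Function.update _ s x) t y)),
        sub_eq_zero] at this
      rw [hb s t hne, hb' s t hne, this]
    · rintro hφ ⟨i, j, k, l⟩ s t hst w
      have hne : s ≠ t := by rintro rfl; omega
      simp only [← smul_eq_mul]
      rw [sum_frtCoeff _ _ _ _ (fun x y => φ (Function.update (Function.update _ s x) t y)),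
        sub_eq_zero]
      have := DFunLike.congr_fun (hφ s t hst
        (Function.update (Function.update (fun a => (w a).1) s i) t j))
        (Function.update (Function.update (fun a => (w a).2) s k) t l)
      rw [hb s t hne, hb' s t hne] at this
      simp only [pair_update, Function.update_self, Function.update_of_ne hne,
        update_update_update_update] at this
      exact (smul_right_injective ℂ hp) this
  rw [h]
  exact ((pairEquiv m n).ofSubmodule' _).finrank_eq

end Solutions

/-! ### The skew presentation of the exterior algebra -/

section Presentation

variable {n : ℕ} {q p : ℂ}

theorem eq_zero_of_eq_neg_self {N : Type*} [AddCommGroup N] [Module ℂ N] {x : N} (h : x = -x) :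
    x = 0 := by
  have h2 : (2 : ℂ) • x = 0 := by
    rw [two_smul]
    nth_rewrite 2 [h]
    exact add_neg_cancel x
  exact (smul_eq_zero.1 h2).resolve_left two_ne_zero

/-- The reflection k ↦ i + j - k turns the sum into its negative. -/
theorem sum_Ioo_eq_zero {N : Type*} [AddCommGroup N] [Module ℂ N] {F : ℕ → ℕ → N} {i j : ℕ}
    (h : ∀ k ∈ Finset.Ioo j i, F k (i + j - k) = -F (i + j - k) k) :
    ∑ k ∈ Finset.Ioo j i, F k (i + j - k) = 0 := by
  have : ∑ k ∈ Finset.Ioo j i, F k (i + j - k) = -∑ k ∈ Finset.Ioo j i, F k (i + j - k) := by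
    conv_lhs => rw [Finset.sum_congr rfl h, Finset.sum_neg_distrib]
    congr 1
    refine Finset.sum_nbij' (fun k => i + j - k) (fun k => i + j - k) ?_ ?_ ?_ ?_ ?_ <;>
      intro k hk <;> rw [Finset.mem_Ioo] at hk
    · exact Finset.mem_Ioo.2 (by omega)
    · exact Finset.mem_Ioo.2 (by omega)
    · omega
    · omega
    · rw [show i + j - (i + j - k) = k by omega]
  exact eq_zero_of_eq_neg_self this

/-- Induction on i - j: the terms strictly between cancel by antisymmetry at smaller distance,
leaving q(F i j + F j i) = 0. On the diagonal the relation is (q + q⁻¹) F i i = 0, where q² ≠ -1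
enters. The relations with i < j add nothing. -/
theorem antisymm_iff {N : Type*} [AddCommGroup N] [Module ℂ N] (hq : q ≠ 0) (hq2 : q ^ 2 ≠ -1)
    (F : ℕ → ℕ → N) (n : ℕ) :
    (∀ i j, i < n → j < n → q⁻¹ • F j i + (q • F i j + (q - q⁻¹) •
      (∑ k ∈ Finset.Ico j i, F k (i + j - k) - ∑ k ∈ Finset.Ico i j, F k (i + j - k))) = 0) ↔
    ∀ i j, i < n → j < n → F i j = -F j i := by
  have hq' : q⁻¹ + q ≠ 0 := by
    intro h
    apply hq2
    field_simp at h
    linear_combination h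
  constructor
  · intro h
    have key : ∀ d i j, i < n → j + d = i → F i j = -F j i := by
      intro d
      induction d using Nat.strong_induction_on with
      | _ d IH =>
      rintro i j hi rfl
      have hij := h (j + d) j hi (by omega)
      rcases Nat.eq_zero_or_pos d with rfl | hd
      · simp only [add_zero, Finset.Ico_self, Finset.sum_empty, sub_self, smul_zero,
          ← add_smul] at hij ⊢
        rw [(smul_eq_zero.1 hij).resolve_left hq', neg_zero]
      · rw [Finset.Ico_eq_empty_of_le (show j ≤ j + d by omega), Finset.sum_empty, sub_zero,
          ← Finset.Ioo_insert_left (by omega), Finset.sum_insert Finset.left_notMem_Ioo,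
          sum_Ioo_eq_zero, add_zero, Nat.add_sub_cancel] at hij
        · have : q • (F (j + d) j + F j (j + d)) = 0 := by
            rw [← hij]
            module
          exact eq_neg_of_add_eq_zero_left ((smul_eq_zero.1 this).resolve_left hq)
        · intro k hk
          rw [Finset.mem_Ioo] at hk
          rcases le_total k (j + d + j - k) with h' | h'
          · rw [IH (j + d + j - k - k) (by omega) (j + d + j - k) k (by omega) (by omega), neg_neg]
          · exact IH (k - (j + d + j - k)) (by omega) k (j + d + j - k) (by omega) (by omega)
    intro i j hi hj
    rcases le_total j i with h' | h'
    · exact key (i - j) i j hi (by omega)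
    · rw [key (j - i) j i hj (by omega), neg_neg]
  · intro h i j hi hj
    have h0 : ∀ i j, i < n → ∑ k ∈ Finset.Ioo j i, F k (i + j - k) = 0 := fun i j hi =>
      sum_Ioo_eq_zero fun k hk => by
        rw [Finset.mem_Ioo] at hk
        exact h _ _ (by omega) (by omega)
    rcases lt_trichotomy j i with h' | rfl | h'
    · rw [Finset.Ico_eq_empty_of_le h'.le, Finset.sum_empty, sub_zero,
        ← Finset.Ioo_insert_left h', Finset.sum_insert Finset.left_notMem_Ioo, h0 i j hi,
        Nat.add_sub_cancel, h i j hi hj]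
      module
    · have := eq_zero_of_eq_neg_self (h j j hj hj)
      simp [this]
    · rw [Finset.Ico_eq_empty_of_le h'.le, Finset.sum_empty, zero_sub, add_comm i j,
        ← Finset.Ioo_insert_left h', Finset.sum_insert Finset.left_notMem_Ioo, h0 j i hj,
        Nat.add_sub_cancel, h i j hi hj]
      module

theorem ext_relations_iff (hq : q ≠ 0) (hp : p ≠ 0) (hq2 : q ^ 2 ≠ -1) {B : Type*} [Ring B]
    [Algebra ℂ B] (y : Fin n → B) :
    (∀ i j, q⁻¹ • (y j * y i) + p • ∑ k, ∑ l, R n q p i j k l • (y k * y l) = 0) ↔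
      ∀ i j, y i * y j = -(p ^ (2 * ((i : ℤ) - (j : ℤ))) • (y j * y i)) := by
  -- The weight p^(2l) removes p from the relations; extension by zero allows natural number indices
  -- as in `sum_R_one`.
  set F : ℕ → ℕ → B := fun k l => if h : k < n ∧ l < n then
    p ^ (2 * (l : ℤ)) • (y ⟨k, h.1⟩ * y ⟨l, h.2⟩) else 0 with hF
  have hFy : ∀ k l : Fin n, F k l = p ^ (2 * (l : ℤ)) • (y k * y l) := fun k l => by
    rw [hF]
    exact dif_pos ⟨k.2, l.2⟩
  have h1 : ∀ i j : Fin n, p ^ (2 * (i : ℤ)) • (q⁻¹ • (y j * y i) +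
      p • ∑ k, ∑ l, R n q p i j k l • (y k * y l)) = q⁻¹ • F j i + (q • F i j + (q - q⁻¹) •
      (∑ k ∈ Finset.Ico (j : ℕ) i, F k (i + j - k) -
        ∑ k ∈ Finset.Ico (i : ℕ) j, F k (i + j - k))) := by
    intro i j
    rw [← sum_R_one, smul_add, hFy, smul_comm]
    congr 1
    simp only [Finset.smul_sum, smul_smul, hFy]
    refine Finset.sum_congr rfl fun k _ => Finset.sum_congr rfl fun l _ => ?_
    congr 1
    rw [p_mul_R hp, ← mul_assoc, ← zpow_add₀ hp, mul_comm]
    congr 2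
    ring
  have h2 : ∀ i j : Fin n, p ^ (2 * (j : ℤ)) • (y i * y j) =
      p ^ (2 * (j : ℤ)) • -(p ^ (2 * ((i : ℤ) - (j : ℤ))) • (y j * y i)) ↔ F i j = -F j i := by
    intro i j
    rw [hFy, hFy, smul_neg, smul_smul, ← zpow_add₀ hp]
    ring_nf
  have hpz : ∀ z : ℤ, p ^ z ≠ 0 := fun z => zpow_ne_zero z hp
  trans ∀ i j : Fin n, F i j = -F j i
  · rw [show (∀ i j : Fin n, F i j = -F j i) ↔ ∀ i j, i < n → j < n → F i j = -F j i from
      ⟨fun h i j hi hj => h ⟨i, hi⟩ ⟨j, hj⟩, fun h i j => h i j i.2 j.2⟩,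
      ← antisymm_iff hq hq2 F n]
    refine ⟨fun h i j hi hj => ?_, fun h i j => ?_⟩
    · have := h1 ⟨i, hi⟩ ⟨j, hj⟩
      rw [h ⟨i, hi⟩ ⟨j, hj⟩, smul_zero] at this
      exact this.symm
    · have := h1 i j
      rw [h i j i.2 j.2] at this
      exact (smul_eq_zero.1 this).resolve_left (hpz _)
  · refine forall₂_congr fun i j => ?_
    rw [← h2]
    exact (smul_right_injective B (hpz _)).eq_iff

theorem gen_ext_relation (i j : Fin n) :
    q⁻¹ • (gen (ExtRel n q p) j * gen (ExtRel n q p) i) + p • ∑ k, ∑ l, R n q p i j k l •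
      (gen (ExtRel n q p) k * gen (ExtRel n q p) l) = 0 := by
  have := RingQuot.mkAlgHom_rel ℂ (ExtRel.rel (q := q) (p := p) i j)
  simp only [map_add, map_smul, map_sum, map_mul, map_zero] at this
  exact this

theorem gen_skew_relation (i j : Fin n) :
    gen (SkewRel n p) i * gen (SkewRel n p) j =
      -(p ^ (2 * ((i : ℤ) - (j : ℤ))) • (gen (SkewRel n p) j * gen (SkewRel n p) i)) := by
  have := RingQuot.mkAlgHom_rel ℂ (SkewRel.swap (p := p) i j)
  simp only [map_neg, map_smul, map_mul] at this
  exact this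

/-- The comparison map from the algebra presented by `SkewRel` to the exterior algebra. -/
noncomputable def skewToExt (hq : q ≠ 0) (hp : p ≠ 0) (hq2 : q ^ 2 ≠ -1) :
    SkewExt n p →ₐ[ℂ] Ext n q p :=
  RingQuot.liftAlgHom ℂ ⟨RingQuot.mkAlgHom ℂ (ExtRel n q p), fun {a b} h => by
    have hy := (ext_relations_iff hq hp hq2 _).1 (gen_ext_relation (n := n) (q := q) (p := p))
    cases h with
    | sq i =>
      have := hy i i
      rw [sub_self, mul_zero, zpow_zero, one_smul] at this
      rw [map_pow, map_zero, sq]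
      exact eq_zero_of_eq_neg_self this
    | swap i j =>
      rw [map_mul, map_neg, map_smul, map_mul]
      exact hy i j⟩

/-- The comparison map from the exterior algebra to the algebra presented by `SkewRel`. -/
noncomputable def extToSkew (hq : q ≠ 0) (hp : p ≠ 0) (hq2 : q ^ 2 ≠ -1) :
    Ext n q p →ₐ[ℂ] SkewExt n p :=
  RingQuot.liftAlgHom ℂ ⟨RingQuot.mkAlgHom ℂ (SkewRel n p), fun {a b} h => by
    have hy := (ext_relations_iff hq hp hq2 _).2 (gen_skew_relation (n := n) (p := p))
    cases h with
    | rel i j =>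
      simp only [map_add, map_smul, map_sum, map_mul, map_zero]
      exact hy i j⟩

theorem skewToExt_gen (hq : q ≠ 0) (hp : p ≠ 0) (hq2 : q ^ 2 ≠ -1) (i : Fin n) :
    skewToExt hq hp hq2 (gen (SkewRel n p) i) = gen (ExtRel n q p) i :=
  RingQuot.liftAlgHom_mkAlgHom_apply ℂ _ _ _

theorem extToSkew_gen (hq : q ≠ 0) (hp : p ≠ 0) (hq2 : q ^ 2 ≠ -1) (i : Fin n) :
    extToSkew hq hp hq2 (gen (ExtRel n q p) i) = gen (SkewRel n p) i :=
  RingQuot.liftAlgHom_mkAlgHom_apply ℂ _ _ _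

theorem exists_skewExt_equiv (hq : q ≠ 0) (hp : p ≠ 0) (hq2 : q ^ 2 ≠ -1) :
    ∃ e : SkewExt n p ≃ₐ[ℂ] Ext n q p,
      ∀ i : Fin n, e (gen (SkewRel n p) i) = gen (ExtRel n q p) i :=
  ⟨AlgEquiv.ofAlgHom (skewToExt hq hp hq2) (extToSkew hq hp hq2)
    (RingQuot.ringQuot_ext' ℂ _ _ (FreeAlgebra.hom_ext (funext fun i =>
      (congrArg _ (extToSkew_gen hq hp hq2 i)).trans (skewToExt_gen hq hp hq2 i))))
    (RingQuot.ringQuot_ext' ℂ _ _ (FreeAlgebra.hom_ext (funext fun i =>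
      (congrArg _ (skewToExt_gen hq hp hq2 i)).trans (extToSkew_gen hq hp hq2 i)))),
    skewToExt_gen hq hp hq2⟩

end Presentation

/-! ### Dimensions of the graded pieces -/

section PoincareSeries

variable {n : ℕ} {q p : ℂ}

theorem finrank_degPart_symRel (hq : q ≠ 0) (hp : p ≠ 0) (m : ℕ) :
    Module.finrank ℂ (degPart (SymRel n q p) m) = n.multichoose m := by
  have hc : ∀ i j : Fin n, q • (FreeAlgebra.ι ℂ j * FreeAlgebra.ι ℂ i) -
      p • ∑ k, ∑ l, R n q p i j k l • (FreeAlgebra.ι ℂ k * FreeAlgebra.ι ℂ l) =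
      ∑ x, ∑ y, eigenCoeff n q p 1 q (i, j) x y • (FreeAlgebra.ι ℂ x * FreeAlgebra.ι ℂ y) := by
    intro i j
    rw [sum_eigenCoeff _ _ _ _ (fun x y => FreeAlgebra.ι ℂ x * FreeAlgebra.ι ℂ y), one_smul]
    simp only [Finset.smul_sum, smul_smul]
  rw [finrank_degPart (c := eigenCoeff n q p 1 q), finrank_quadSol_eigenCoeff one_ne_zero,
    finrank_heckeHom hq hp (isHecke_smul (by field_simp; ring)), finrank_pi_tieInv_self]
  · rintro a b ⟨i, j⟩
    exact ⟨(i, j), hc i j⟩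
  · rintro ⟨i, j⟩
    exact ⟨_, _, SymRel.rel i j, hc i j⟩

theorem finrank_degPart_extRel (hq : q ≠ 0) (hp : p ≠ 0) (hq2 : q ^ 2 ≠ -1) (m : ℕ) :
    Module.finrank ℂ (degPart (ExtRel n q p) m) = n.choose m := by
  have hc : ∀ i j : Fin n, (q⁻¹ • (FreeAlgebra.ι ℂ j * FreeAlgebra.ι ℂ i) +
      p • ∑ k, ∑ l, R n q p i j k l • (FreeAlgebra.ι ℂ k * FreeAlgebra.ι ℂ l)) - 0 =
      ∑ x, ∑ y, eigenCoeff n q p (-1) (-q⁻¹) (i, j) x y •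
        (FreeAlgebra.ι ℂ x * FreeAlgebra.ι ℂ y) := by
    intro i j
    rw [sum_eigenCoeff _ _ _ _ (fun x y => FreeAlgebra.ι ℂ x * FreeAlgebra.ι ℂ y)]
    simp only [Finset.smul_sum, smul_smul]
    module
  rw [finrank_degPart (c := eigenCoeff n q p (-1) (-q⁻¹)),
    finrank_quadSol_eigenCoeff (neg_ne_zero.2 one_ne_zero),
    finrank_heckeHom hq hp (isHecke_smul (by field_simp; ring)), finrank_pi_tieInv_neg_inv hq hq2]
  · rintro a b ⟨i, j⟩
    exact ⟨(i, j), hc i j⟩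
  · rintro ⟨i, j⟩
    exact ⟨_, _, ExtRel.rel i j, hc i j⟩

theorem finrank_degPart_frtRel (hq : q ≠ 0) (hp : p ≠ 0) (m : ℕ) :
    Module.finrank ℂ (degPart (FRTRel n q p) m) = (n ^ 2).multichoose m := by
  rw [finrank_degPart (c := frtCoeff n q p), finrank_quadSol_frtCoeff hp,
    finrank_heckeHom hq hp (isHecke_braidOp hq hp), finrank_pi_tieInv_braidOp hq hp]
  · rintro a b ⟨i, j, k, l⟩
    exact ⟨(i, j, k, l), (sum_frtCoeff i j k l
      (fun x y => FreeAlgebra.ι ℂ x * FreeAlgebra.ι ℂ y)).symm⟩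
  · rintro ⟨i, j, k, l⟩
    exact ⟨_, _, FRTRel.rel i j k l, (sum_frtCoeff i j k l
      (fun x y => FreeAlgebra.ι ℂ x * FreeAlgebra.ι ℂ y)).symm⟩

end PoincareSeries

end CremmerGervais

theorem mainTheorem8 (n : ℕ) (q p : ℂ) (hq : q ≠ 0) (hp : p ≠ 0) :
    (q ^ 2 ≠ -1 →
      (∃ e : CremmerGervais.SkewExt n p ≃ₐ[ℂ] CremmerGervais.Ext n q p,
        ∀ i : Fin n, e (CremmerGervais.gen (CremmerGervais.SkewRel n p) i) =
          CremmerGervais.gen (CremmerGervais.ExtRel n q p) i) ∧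
      CremmerGervais.poincareSeries (CremmerGervais.degPart (CremmerGervais.ExtRel n q p)) =
        (1 + PowerSeries.X) ^ n) ∧
    CremmerGervais.poincareSeries (CremmerGervais.degPart (CremmerGervais.SymRel n q p)) =
      ((1 - PowerSeries.X) ^ n)⁻¹ ∧
    CremmerGervais.poincareSeries (CremmerGervais.degPart (CremmerGervais.FRTRel n q p)) =
      ((1 - PowerSeries.X) ^ (n ^ 2))⁻¹ := by
  refine ⟨fun hq2 => ⟨CremmerGervais.exists_skewExt_equiv hq hp hq2, ?_⟩, ?_, ?_⟩
  · rw [← CremmerGervais.mk_choose]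
    simp only [CremmerGervais.poincareSeries, CremmerGervais.finrank_degPart_extRel hq hp hq2]
  · rw [← CremmerGervais.mk_multichoose]
    simp only [CremmerGervais.poincareSeries, CremmerGervais.finrank_degPart_symRel hq hp]
  · rw [← CremmerGervais.mk_multichoose]
    simp only [CremmerGervais.poincareSeries, CremmerGervais.finrank_degPart_frtRel hq hp]
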